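/- Let $p,q\ge 0$ be integers, let $\mathfrak g=\mathfrak{gl}(2p|2q)$ be the complex general linear Lie superalgebra, realized on $\mathbb C^{p|q}\oplus\mathbb C^{p|q}$ as $2\times 2$ block matrices with blocks of size $p|q$. Let $\mathfrak k=\mathfrak{gl}(p|q)\oplus\mathfrak{gl}(p|q)$ be the subalgebra of block diagonal matrices, let $\mathfrak p^+$ be the space of matrices whose only non-zero block is the upper right one, and put $\mathfrak q=\mathfrak k\oplus\mathfrak p^+$. Let $\mathscr H(p,q)$ be the set of $(p,q)$-hook partitions, i.e. partitions $\lambda=(\lambda_1\ge\lambda_2\ge\cdots)$ with $\lambda_{p+1}\le q$; write $\lambda'$ for the transpose of $\lambda$. For $\lambda\in\mathscr H(p,q)$ put $$\lambda^\natural=(\lambda_1,\dots,\lambda_p,\langle\lambda_1'-p\rangle,\dots,\langle\lambda_q'-p\rangle),\qquad \langle x\rangle=\max\{x,0\},$$ and let $L(\lambda^\natural)$ be the irreducible $\mathfrak{gl}(p|q)$-module of highest weight $\sum_{i\le p}\lambda_i\epsilon_i+\sum_{j\le q}\langle\lambda'_j-p\rangle\delta_j$ with respect to the standard (upper triangular)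 Borel subalgebra. Let $W_\lambda=L(\lambda^\natural)\otimes L(\lambda^\natural)^*$ be the $\mathfrak k$-module on which the first copy of $\mathfrak{gl}(p|q)$ acts on the first factor and the second copy acts on the second factor contragrediently, that is, on the space $L(\lambda^\natural)$ through the negative supertranspose. Extend $W_\lambda$ to a $\mathfrak q$-module by letting $\mathfrak p^+$ act by zero, and let $$I_\lambda=\mathfrak U(\mathfrak g)\otimes_{\mathfrak U(\mathfrak q)}W_\lambda$$ be the generalized Verma module. Then for all $\lambda,\mu\in\mathscr H(p,q)$: if $\operatorname{Hom}_{\mathfrak k}(W_\mu,I_\lambda)\ne\{0\}$ (homomorphisms of either parity being allowed), then $\lambda\supseteq\mu$, i.e. $\lambda_i\ge\mu_i$ for all $i$. -/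

import Mathlib

open scoped TensorProduct

noncomputable section

namespace SuperPair

/-! ### Supermatrices

An index type `ι` with a parity function `π : ι → ZMod 2` gives the superspace with homogeneous
basis indexed by `ι`, and `Matrix ι ι ℂ` is its general linear Lie superalgebra. -/

/-- The sign `(-1)^(a b)` attached to two parities. -/
def sgn (a b : ZMod 2) : ℂ := if a = 1 ∧ b = 1 then -1 else 1

lemma sgn_zero_left (b : ZMod 2) : sgn 0 b = 1 := by simp [sgn]

lemma sgn_one_one : sgn 1 1 = -1 := by simp [sgn]

lemma sgn_mul_self (a b : ZMod 2) : sgn a b * sgn a b = 1 := by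
  unfold sgn; split_ifs <;> norm_num

lemma sgn_comm (a b : ZMod 2) : sgn a b = sgn b a := by
  unfold sgn; congr 1; exact propext and_comm

lemma sgn_add (a b c : ZMod 2) : sgn (a + b) c = sgn a c * sgn b c := by
  have h : ∀ a : ZMod 2, a = 0 ∨ a = 1 := by decide
  have h2 : (1 : ZMod 2) + 1 = 0 := by decide
  rcases h a with rfl | rfl <;> rcases h b with rfl | rfl <;> rcases h c with rfl | rfl <;>
    simp [sgn, h2]

section General

variable {ι : Type} [Fintype ι]

/-- The homogeneous supermatrices of parity `a`. -/
def homog (π : ι → ZMod 2) (a : ZMod 2) : Submodule ℂ (Matrix ι ι ℂ) where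
  carrier := {X | ∀ i j, π i + π j ≠ a → X i j = 0}
  zero_mem' := fun _ _ _ => rfl
  add_mem' := fun {X Y} hX hY i j h => by simp [hX i j h, hY i j h]
  smul_mem' := fun c X hX i j h => by simp [hX i j h]

lemma homog_mul {π : ι → ZMod 2} {a b : ZMod 2} {X Y : Matrix ι ι ℂ}
    (hX : X ∈ homog π a) (hY : Y ∈ homog π b) : X * Y ∈ homog π (a + b) := by
  intro i j h
  rw [Matrix.mul_apply]
  refine Finset.sum_eq_zero fun k _ => ?_
  by_cases h1 : π i + π k = a
  · by_cases h2 : π k + π j = b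
    · exfalso
      apply h
      have h3 : ∀ x : ZMod 2, x + x = 0 := by decide
      rw [← h1, ← h2]
      linear_combination -h3 (π k)
    · rw [hY k j h2, mul_zero]
  · rw [hX i k h1, zero_mul]

/-- The component of parity `a` of a supermatrix. -/
def part (π : ι → ZMod 2) (a : ZMod 2) : Matrix ι ι ℂ →ₗ[ℂ] Matrix ι ι ℂ where
  toFun X := Matrix.of fun i j => if π i + π j = a then X i j else 0
  map_add' X Y := by ext i j; by_cases h : π i + π j = a <;> simp [h]
  map_smul' c X := by ext i j; by_cases h : π i + π j = a <;> simp [h]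

lemma part_of_mem {π : ι → ZMod 2} {a : ZMod 2} {X : Matrix ι ι ℂ} (hX : X ∈ homog π a)
    (b : ZMod 2) : part π b X = if b = a then X else 0 := by
  ext i j
  by_cases h : π i + π j = a
  · by_cases hb : b = a
    · simp [part, h, hb]
    · simp [part, h, hb, Ne.symm hb]
  · by_cases hb : b = a <;> simp [part, hb, hX i j h]

/-- The parity automorphism `X ↦ (-1)^|X| X`. -/
def flip (π : ι → ZMod 2) : Matrix ι ι ℂ →ₗ[ℂ] Matrix ι ι ℂ := part π 0 - part π 1

lemma flip_of_mem {π : ι → ZMod 2} {a : ZMod 2} {X : Matrix ι ι ℂ} (hX : X ∈ homog π a) :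
    flip π X = sgn a 1 • X := by
  have h : ∀ a : ZMod 2, a = 0 ∨ a = 1 := by decide
  rcases h a with rfl | rfl <;> simp [flip, part_of_mem hX, sgn]

/-- The supertranspose: `(A, B; C, D) ↦ (Aᵗ, -Cᵗ; Bᵗ, Dᵗ)` in the block form given by parity.
Its negative is the matrix of the action on the dual basis of the dual superspace. -/
def stranspose (π : ι → ZMod 2) : Matrix ι ι ℂ →ₗ[ℂ] Matrix ι ι ℂ where
  toFun X := Matrix.of fun i j => sgn (π j) (π i + π j) * X j i
  map_add' X Y := by ext i j; simp [mul_add]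
  map_smul' c X := by ext i j; simp [mul_left_comm]

lemma stranspose_mem {π : ι → ZMod 2} {a : ZMod 2} {X : Matrix ι ι ℂ} (hX : X ∈ homog π a) :
    stranspose π X ∈ homog π a := by
  intro i j h
  have : X j i = 0 := hX j i (by rwa [add_comm])
  simp [stranspose, this]

lemma stranspose_mul {π : ι → ZMod 2} {a b : ZMod 2} {X Y : Matrix ι ι ℂ}
    (hX : X ∈ homog π a) (hY : Y ∈ homog π b) :
    stranspose π (X * Y) = sgn a b • (stranspose π Y * stranspose π X) := by
  ext i j
  simp only [stranspose, LinearMap.coe_mk, AddHom.coe_mk, Matrix.of_apply, Matrix.mul_apply,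
    Matrix.smul_apply, smul_eq_mul, Finset.mul_sum]
  refine Finset.sum_congr rfl fun k _ => ?_
  by_cases h1 : π j + π k = a
  · by_cases h2 : π k + π i = b
    · subst h1 h2
      have key : ∀ x y z : ZMod 2, sgn y (x + y) =
          sgn (y + z) (z + x) * (sgn z (x + z) * sgn y (z + y)) := by
        have h : ∀ a : ZMod 2, a = 0 ∨ a = 1 := by decide
        have h2 : (1 : ZMod 2) + 1 = 0 := by decide
        intro x y z
        rcases h x with rfl | rfl <;> rcases h y with rfl | rfl <;> rcases h z with rfl | rfl <;>
          simp [sgn, h2]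
      rw [key (π i) (π j) (π k)]
      ring
    · rw [hY k i h2]; ring
  · rw [hX j k h1]; ring

/-! ### The enveloping superalgebra -/

/-- The defining relations `x y - (-1)^(|x||y|) y x = [x, y]` for homogeneous `x`, `y`, where
`[x, y]` is the supercommutator of supermatrices. -/
inductive Rel (π : ι → ZMod 2) :
    TensorAlgebra ℂ (Matrix ι ι ℂ) → TensorAlgebra ℂ (Matrix ι ι ℂ) → Prop
  | bracket (a b : ZMod 2) (X Y : Matrix ι ι ℂ) (hX : X ∈ homog π a) (hY : Y ∈ homog π b) :
    Rel π
      (TensorAlgebra.ι ℂ X * TensorAlgebra.ι ℂ Y -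
        sgn a b • (TensorAlgebra.ι ℂ Y * TensorAlgebra.ι ℂ X))
      (TensorAlgebra.ι ℂ (X * Y - sgn a b • (Y * X)))

/-- The universal enveloping superalgebra of the Lie superalgebra of all supermatrices. -/
def U (π : ι → ZMod 2) : Type := RingQuot (Rel π)

instance (π : ι → ZMod 2) : Ring (U π) := inferInstanceAs (Ring (RingQuot (Rel π)))

instance (π : ι → ZMod 2) : Algebra ℂ (U π) := inferInstanceAs (Algebra ℂ (RingQuot (Rel π)))

/-- The quotient map from the tensor algebra. -/
def U.mk (π : ι → ZMod 2) : TensorAlgebra ℂ (Matrix ι ι ℂ) →ₐ[ℂ] U π :=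
  RingQuot.mkAlgHom ℂ (Rel π)

/-- The canonical map from supermatrices to the enveloping superalgebra. -/
def U.of (π : ι → ZMod 2) : Matrix ι ι ℂ →ₗ[ℂ] U π :=
  (U.mk π).toLinearMap ∘ₗ TensorAlgebra.ι ℂ

lemma U.of_bracket {π : ι → ZMod 2} {a b : ZMod 2} {X Y : Matrix ι ι ℂ}
    (hX : X ∈ homog π a) (hY : Y ∈ homog π b) :
    U.of π X * U.of π Y - sgn a b • (U.of π Y * U.of π X) =
      U.of π (X * Y - sgn a b • (Y * X)) := by
  have h : U.mk π _ = U.mk π _ := RingQuot.mkAlgHom_rel ℂ (Rel.bracket a b X Y hX hY)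
  rw [map_sub, map_smul, map_mul, map_mul] at h
  exact h

/-- The parity automorphism of the enveloping superalgebra, `x ↦ (-1)^|x| x` on generators. -/
def U.parity (π : ι → ZMod 2) : U π →ₐ[ℂ] U π :=
  RingQuot.liftAlgHom ℂ ⟨TensorAlgebra.lift ℂ (U.of π ∘ₗ flip π), by
    rintro _ _ ⟨a, b, X, Y, hX, hY⟩
    have hXY : X * Y - sgn a b • (Y * X) ∈ homog π (a + b) :=
      Submodule.sub_mem _ (homog_mul hX hY)
        (Submodule.smul_mem _ _ (by rw [add_comm]; exact homog_mul hY hX))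
    have e := congrArg (U.of π) (flip_of_mem hXY)
    rw [map_smul, ← U.of_bracket hX hY] at e
    rw [TensorAlgebra.lift_ι_apply, LinearMap.comp_apply, e]
    simp only [map_sub, map_smul, map_mul, TensorAlgebra.lift_ι_apply, LinearMap.comp_apply,
      flip_of_mem hX, flip_of_mem hY, sgn_add]
    simp only [smul_mul_assoc, mul_smul_comm, smul_smul, smul_sub]
    congr 2 <;> ring⟩

lemma U.parity_of (π : ι → ZMod 2) (X : Matrix ι ι ℂ) :
    U.parity π (U.of π X) = U.of π (flip π X) := by
  refine (RingQuot.liftAlgHom_mkAlgHom_apply ℂ _ _ _).trans ?_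
  rw [TensorAlgebra.lift_ι_apply, LinearMap.comp_apply]

lemma U.parity_of_mem {π : ι → ZMod 2} {a : ZMod 2} {X : Matrix ι ι ℂ} (hX : X ∈ homog π a) :
    U.parity π (U.of π X) = sgn a 1 • U.of π X := by
  rw [U.parity_of, flip_of_mem hX, map_smul]

lemma flip_flip (π : ι → ZMod 2) (X : Matrix ι ι ℂ) : flip π (flip π X) = X := by
  have h : ∀ a : ZMod 2, a = 0 ∨ a = 1 := by decide
  ext i j
  rcases h (π i + π j) with h | h <;> simp [flip, part, h]

lemma U.parity_parity (π : ι → ZMod 2) (u : U π) : U.parity π (U.parity π u) = u := by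
  have : (U.parity π).comp (U.parity π) = AlgHom.id ℂ (U π) := by
    apply RingQuot.ringQuot_ext'
    apply TensorAlgebra.hom_ext
    ext1 X
    change U.parity π (U.parity π (U.of π X)) = U.of π X
    rw [U.parity_of, U.parity_of, flip_flip]
  exact DFunLike.congr_fun this u

/-! ### Supermodules -/

/-- A module structure on `V` over a sub-superspace `𝔰` of supermatrices (used for Lie
subsuperalgebras): `par` is the parity operator `v ↦ (-1)^|v| v`, and `act` respects parity and
supercommutators. -/
structure SuperModule (π : ι → ZMod 2) (𝔰 : Submodule ℂ (Matrix ι ι ℂ))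
    (V : Type) [AddCommGroup V] [Module ℂ V] where
  act : 𝔰 →ₗ[ℂ] Module.End ℂ V
  par : Module.End ℂ V
  par_par : ∀ v, par (par v) = v
  par_act : ∀ (a : ZMod 2) (X : 𝔰), (X : Matrix ι ι ℂ) ∈ homog π a →
    ∀ v, par (act X v) = sgn a 1 • act X (par v)
  act_bracket : ∀ (a b : ZMod 2) (X Y Z : 𝔰), (X : Matrix ι ι ℂ) ∈ homog π a →
    (Y : Matrix ι ι ℂ) ∈ homog π b →
    (Z : Matrix ι ι ℂ) = (X : Matrix ι ι ℂ) * Y - sgn a b • ((Y : Matrix ι ι ℂ) * X) →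
    ∀ v, act Z v = act X (act Y v) - sgn a b • act Y (act X v)

section Modules

variable {π : ι → ZMod 2} {V V₁ V₂ : Type} [AddCommGroup V] [Module ℂ V]
  [AddCommGroup V₁] [Module ℂ V₁] [AddCommGroup V₂] [Module ℂ V₂]

/-- Restriction to a smaller subspace. -/
def SuperModule.restrict {𝔰 𝔱 : Submodule ℂ (Matrix ι ι ℂ)} (M : SuperModule π 𝔱 V) (h : 𝔰 ≤ 𝔱) :
    SuperModule π 𝔰 V where
  act := M.act ∘ₗ Submodule.inclusion h
  par := M.par
  par_par := M.par_par
  par_act a X hX v := M.par_act a (Submodule.inclusion h X) hX v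
  act_bracket a b X Y Z hX hY hZ v :=
    M.act_bracket a b (Submodule.inclusion h X) (Submodule.inclusion h Y)
      (Submodule.inclusion h Z) hX hY hZ v

/-- The homomorphisms of parity `c`: linear maps `f` of parity `c` such that
`f (X v) = (-1)^(|X| c) X (f v)`. -/
def SuperModule.homOfParity {𝔰 : Submodule ℂ (Matrix ι ι ℂ)} (M : SuperModule π 𝔰 V₁)
    (N : SuperModule π 𝔰 V₂) (c : ZMod 2) : Submodule ℂ (V₁ →ₗ[ℂ] V₂) where
  carrier := {f | (∀ v, N.par (f v) = sgn c 1 • f (M.par v)) ∧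
    ∀ (a : ZMod 2) (X : 𝔰), (X : Matrix ι ι ℂ) ∈ homog π a →
      ∀ v, f (M.act X v) = sgn a c • N.act X (f v)}
  zero_mem' := ⟨fun v => by simp, fun a X hX v => by simp⟩
  add_mem' := fun {f g} hf hg => ⟨fun v => by simp [hf.1 v, hg.1 v],
    fun a X hX v => by simp [hf.2 a X hX v, hg.2 a X hX v]⟩
  smul_mem' := fun r f hf => ⟨fun v => by simp [hf.1 v, smul_comm r],
    fun a X hX v => by simp [hf.2 a X hX v, smul_comm r]⟩

/-- The superspace of all homomorphisms: sums of even and odd ones. -/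
def SuperModule.Hom {𝔰 : Submodule ℂ (Matrix ι ι ℂ)} (M : SuperModule π 𝔰 V₁)
    (N : SuperModule π 𝔰 V₂) : Submodule ℂ (V₁ →ₗ[ℂ] V₂) :=
  M.homOfParity N 0 ⊔ M.homOfParity N 1

/-- A `U π`-module with a compatible parity operator is a supermodule over all supermatrices. -/
def SuperModule.ofU [Module (U π) V] [IsScalarTower ℂ (U π) V]
    (P : V →ₛₗ[(U.parity π : U π →+* U π)] V) (hP : ∀ v, P (P v) = v) : SuperModule π ⊤ V where
  act := (Algebra.lsmul ℂ ℂ V).toLinearMap ∘ₗ U.of π ∘ₗ Submodule.subtype ⊤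
  par :=
    { toFun := P
      map_add' := P.map_add
      map_smul' := fun c v => by
        rw [← algebraMap_smul (U π) c v, P.map_smulₛₗ]
        simp }
  par_par := hP
  par_act a X hX v := by
    change P (U.of π X • v) = sgn a 1 • (U.of π X • P v)
    rw [P.map_smulₛₗ]
    change U.parity π (U.of π X) • P v = _
    rw [U.parity_of_mem hX, smul_assoc]
  act_bracket a b X Y Z hX hY hZ v := by
    change U.of π Z • v = U.of π X • U.of π Y • v - sgn a b • (U.of π Y • U.of π X • v)
    rw [hZ, ← U.of_bracket hX hY, sub_smul, smul_assoc, mul_smul, mul_smul]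

/-- The contragredient twist: the same superspace, `X` acting through its negative
supertranspose. -/
def SuperModule.contragredient (M : SuperModule π ⊤ V) : SuperModule π ⊤ V where
  act := M.act ∘ₗ (LinearMap.codRestrict ⊤ (-stranspose π) fun _ => trivial) ∘ₗ
    Submodule.subtype ⊤
  par := M.par
  par_par := M.par_par
  par_act a X hX v := M.par_act a _ (Submodule.neg_mem _ (stranspose_mem hX)) v
  act_bracket a b X Y Z hX hY hZ v := by
    refine M.act_bracket a b _ _ _ (Submodule.neg_mem _ (stranspose_mem hX))
      (Submodule.neg_mem _ (stranspose_mem hY)) ?_ v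
    change -(stranspose π Z) = -(stranspose π X) * -(stranspose π Y) -
      sgn a b • (-(stranspose π Y) * -(stranspose π X))
    rw [hZ, map_sub, map_smul, stranspose_mul hX hY, stranspose_mul hY hX, smul_smul,
      sgn_comm b a, sgn_mul_self]
    simp

/-! ### Induction -/

/-- The `U π`-submodule of `U π ⊗ V` spanned by `u X ⊗ v - u ⊗ X v` for `X` in `𝔰`. -/
def SuperModule.balanced {𝔰 : Submodule ℂ (Matrix ι ι ℂ)} (M : SuperModule π 𝔰 V) :
    Submodule (U π) (U π ⊗[ℂ] V) :=
  Submodule.span (U π)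
    {z | ∃ (u : U π) (X : 𝔰) (v : V),
      z = (u * U.of π (X : Matrix ι ι ℂ)) ⊗ₜ[ℂ] v - u ⊗ₜ[ℂ] (M.act X v)}

/-- The underlying space of the module induced from `𝔰` to all supermatrices: the tensor product
of `U π` and `V` over the enveloping superalgebra of `𝔰` (which is generated by `𝔰`). -/
abbrev SuperModule.IndSpace {𝔰 : Submodule ℂ (Matrix ι ι ℂ)} (M : SuperModule π 𝔰 V) : Type :=
  (U π ⊗[ℂ] V) ⧸ M.balanced

/-- The parity operator on `U π ⊗ V`. -/
def SuperModule.tensorParity {𝔰 : Submodule ℂ (Matrix ι ι ℂ)} (M : SuperModule π 𝔰 V) :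
    (U π ⊗[ℂ] V) →ₛₗ[(U.parity π : U π →+* U π)] (U π ⊗[ℂ] V) where
  toFun := TensorProduct.map (U.parity π).toLinearMap M.par
  map_add' := map_add _
  map_smul' u z := by
    induction z using TensorProduct.induction_on with
    | zero => simp
    | tmul x v => simp [TensorProduct.smul_tmul']
    | add x y hx hy => rw [smul_add, map_add, hx, hy, map_add, smul_add]

lemma SuperModule.tensorParity_tmul {𝔰 : Submodule ℂ (Matrix ι ι ℂ)} (M : SuperModule π 𝔰 V)
    (u : U π) (v : V) : M.tensorParity (u ⊗ₜ[ℂ] v) = U.parity π u ⊗ₜ[ℂ] M.par v := rfl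

lemma SuperModule.tensorParity_tensorParity {𝔰 : Submodule ℂ (Matrix ι ι ℂ)}
    (M : SuperModule π 𝔰 V) (z : U π ⊗[ℂ] V) : M.tensorParity (M.tensorParity z) = z := by
  induction z using TensorProduct.induction_on with
  | zero => simp
  | tmul x v => rw [tensorParity_tmul, tensorParity_tmul, U.parity_parity, M.par_par]
  | add x y hx hy => rw [map_add, map_add, hx, hy]

/-- A subspace of supermatrices is graded if it contains the homogeneous components of its
elements. -/
def IsGraded (π : ι → ZMod 2) (𝔰 : Submodule ℂ (Matrix ι ι ℂ)) : Prop :=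
  ∀ X ∈ 𝔰, ∀ a, part π a X ∈ 𝔰

lemma part_mem (π : ι → ZMod 2) (a : ZMod 2) (X : Matrix ι ι ℂ) : part π a X ∈ homog π a := by
  intro i j h
  simp [part, h]

lemma part_add_part (π : ι → ZMod 2) (X : Matrix ι ι ℂ) : part π 0 X + part π 1 X = X := by
  have h : ∀ a : ZMod 2, a = 0 ∨ a = 1 := by decide
  ext i j
  rcases h (π i + π j) with h | h <;> simp [part, h]

lemma SuperModule.balanced_le {𝔰 : Submodule ℂ (Matrix ι ι ℂ)} (M : SuperModule π 𝔰 V)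
    (h𝔰 : IsGraded π 𝔰) : M.balanced ≤ M.balanced.comap M.tensorParity := by
  refine Submodule.span_le.2 ?_
  rintro _ ⟨u, X, v, rfl⟩
  have key : ∀ (a : ZMod 2) (Y : 𝔰), (Y : Matrix ι ι ℂ) ∈ homog π a →
      M.tensorParity ((u * U.of π (Y : Matrix ι ι ℂ)) ⊗ₜ[ℂ] v - u ⊗ₜ[ℂ] (M.act Y v)) ∈
        M.balanced := by
    intro a Y hY
    have e : M.tensorParity ((u * U.of π (Y : Matrix ι ι ℂ)) ⊗ₜ[ℂ] v - u ⊗ₜ[ℂ] (M.act Y v)) =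
        (U.parity π u * U.of π (((sgn a 1 • Y : 𝔰) : Matrix ι ι ℂ))) ⊗ₜ[ℂ] M.par v -
          U.parity π u ⊗ₜ[ℂ] (M.act (sgn a 1 • Y) (M.par v)) := by
      rw [map_sub, tensorParity_tmul, tensorParity_tmul, map_mul, U.parity_of_mem hY,
        M.par_act a Y hY, Submodule.coe_smul, map_smul, map_smul, LinearMap.smul_apply]
    rw [e]
    exact Submodule.subset_span ⟨_, _, _, rfl⟩
  have hX : X = ⟨part π 0 X, h𝔰 X X.2 0⟩ + ⟨part π 1 X, h𝔰 X X.2 1⟩ :=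
    Subtype.ext (part_add_part π X).symm
  have h0 := key 0 ⟨part π 0 X, h𝔰 X X.2 0⟩ (part_mem π 0 X)
  have h1 := key 1 ⟨part π 1 X, h𝔰 X X.2 1⟩ (part_mem π 1 X)
  have := Submodule.add_mem _ h0 h1
  rw [← map_add] at this
  change M.tensorParity _ ∈ M.balanced
  convert this using 2
  conv_lhs => rw [hX]
  simp only [Submodule.coe_add, map_add, mul_add, TensorProduct.add_tmul, LinearMap.add_apply,
    TensorProduct.tmul_add]
  abel

/-- The induced module, with `U π` acting by left multiplication. -/
def SuperModule.Ind {𝔰 : Submodule ℂ (Matrix ι ι ℂ)} (M : SuperModule π 𝔰 V)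
    (h𝔰 : IsGraded π 𝔰) : SuperModule π ⊤ M.IndSpace :=
  SuperModule.ofU (Submodule.mapQ M.balanced M.balanced M.tensorParity (M.balanced_le h𝔰)) <| by
    intro z
    induction z using Submodule.Quotient.induction_on with
    | H z => rw [Submodule.mapQ_apply, Submodule.mapQ_apply, M.tensorParity_tensorParity]

end Modules

end General

/-! ### Irreducible highest weight modules of `gl(p|q)` -/

section HighestWeight

variable (p q : ℕ)

/-- The parity function of `ℂ^(p|q)`. -/
def parity : Fin p ⊕ Fin q → ZMod 2 := Sum.elim (fun _ => 0) (fun _ => 1)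

variable {p q}

/-- The left ideal generated by the strictly upper triangular matrix units (the order of the
basis is `ε₁ … ε_p δ₁ … δ_q`) and by `E_ii - κ_i`. -/
def vermaIdeal (κ : Fin p ⊕ Fin q → ℂ) : Submodule (U (parity p q)) (U (parity p q)) :=
  Submodule.span (U (parity p q))
    ({x | ∃ i j, Sum.Lex (· < ·) (· < ·) i j ∧ x = U.of (parity p q) (Matrix.single i j 1)} ∪
      {x | ∃ i, x = U.of (parity p q) (Matrix.single i i 1) - algebraMap ℂ _ (κ i)})

/-- The Verma module of highest weight `κ` with respect to the standard Borel subalgebra. -/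
abbrev Verma (κ : Fin p ⊕ Fin q → ℂ) : Type := U (parity p q) ⧸ vermaIdeal κ

/-- The sum of all proper submodules of the Verma module. -/
def vermaRadical (κ : Fin p ⊕ Fin q → ℂ) : Submodule (U (parity p q)) (Verma κ) :=
  sSup {N | N ≠ ⊤}

/-- The irreducible module of highest weight `κ`, as a space. -/
abbrev LSpace (κ : Fin p ⊕ Fin q → ℂ) : Type := Verma κ ⧸ vermaRadical κ

/-- The parity operator on the enveloping superalgebra as a semilinear map. -/
def uParity : U (parity p q) →ₛₗ[(U.parity (parity p q) : U (parity p q) →+* U (parity p q))]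
    U (parity p q) where
  toFun := U.parity (parity p q)
  map_add' := map_add _
  map_smul' := map_mul _

lemma single_mem_homog (i j : Fin p ⊕ Fin q) :
    Matrix.single i j (1 : ℂ) ∈ homog (parity p q) (parity p q i + parity p q j) := by
  intro k l h
  refine Matrix.single_apply_of_ne _ _ _ _ _ ?_
  rintro ⟨rfl, rfl⟩
  exact h rfl

lemma vermaIdeal_le (κ : Fin p ⊕ Fin q → ℂ) : vermaIdeal κ ≤ (vermaIdeal κ).comap uParity := by
  refine Submodule.span_le.2 ?_
  rintro _ (⟨i, j, hij, rfl⟩ | ⟨i, rfl⟩)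
  · change U.parity (parity p q) _ ∈ vermaIdeal κ
    rw [U.parity_of_mem (single_mem_homog i j), ← algebraMap_smul (U (parity p q))]
    exact Submodule.smul_mem _ _ (Submodule.subset_span (Or.inl ⟨i, j, hij, rfl⟩))
  · change U.parity (parity p q) _ ∈ vermaIdeal κ
    have h : ∀ x : ZMod 2, x + x = 0 := by decide
    rw [map_sub, U.parity_of_mem (single_mem_homog i i), h, sgn_zero_left, one_smul,
      AlgHom.commutes]
    exact Submodule.subset_span (Or.inr ⟨i, rfl⟩)

/-- The parity operator on the Verma module; the highest weight vector is even. -/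
def vermaParity (κ : Fin p ⊕ Fin q → ℂ) :
    Verma κ →ₛₗ[(U.parity (parity p q) : U (parity p q) →+* U (parity p q))] Verma κ :=
  Submodule.mapQ _ _ uParity (vermaIdeal_le κ)

lemma vermaParity_vermaParity (κ : Fin p ⊕ Fin q → ℂ) (z : Verma κ) :
    vermaParity κ (vermaParity κ z) = z := by
  induction z using Submodule.Quotient.induction_on with
  | H z =>
    rw [vermaParity, Submodule.mapQ_apply, Submodule.mapQ_apply]
    exact congrArg _ (U.parity_parity _ z)

lemma vermaRadical_le (κ : Fin p ⊕ Fin q → ℂ) :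
    vermaRadical κ ≤ (vermaRadical κ).comap (vermaParity κ) := by
  refine sSup_le fun N hN n hn => ?_
  have h1 : N.comap (vermaParity κ) ≠ ⊤ := by
    intro h
    apply hN
    rw [eq_top_iff]
    intro m _
    have : vermaParity κ m ∈ N.comap (vermaParity κ) := h ▸ Submodule.mem_top
    rwa [Submodule.mem_comap, vermaParity_vermaParity] at this
  refine (le_sSup (α := Submodule _ _) h1 : _ ≤ vermaRadical κ) ?_
  rwa [Submodule.mem_comap, vermaParity_vermaParity]

/-- The irreducible `gl(p|q)`-module of highest weight `κ` with respect to the standard Borel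
subalgebra; the highest weight vector is even. -/
def L (κ : Fin p ⊕ Fin q → ℂ) : SuperModule (parity p q) ⊤ (LSpace κ) :=
  SuperModule.ofU (Submodule.mapQ _ _ (vermaParity κ) (vermaRadical_le κ)) <| by
    intro z
    induction z using Submodule.Quotient.induction_on with
    | H z => rw [Submodule.mapQ_apply, Submodule.mapQ_apply, vermaParity_vermaParity]

end HighestWeight

/-! ### The symmetric pair

`gl(2p|2q)` is realized on the superspace `ℂ^(p|q) ⊕ ℂ^(p|q)`, so that its elements are
`2 × 2` block matrices whose blocks are supermatrices of size `p|q`. -/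

section Pair

variable (p q : ℕ)

/-- The parity function of `ℂ^(p|q) ⊕ ℂ^(p|q) = ℂ^(2p|2q)`. -/
def parity₂ : (Fin p ⊕ Fin q) ⊕ (Fin p ⊕ Fin q) → ZMod 2 := Sum.elim (parity p q) (parity p q)

/-- `gl(2p|2q)` as a space of supermatrices. -/
abbrev G : Type := Matrix ((Fin p ⊕ Fin q) ⊕ (Fin p ⊕ Fin q)) ((Fin p ⊕ Fin q) ⊕ (Fin p ⊕ Fin q)) ℂ

/-- `𝔨 = gl(p|q) ⊕ gl(p|q)`, the block diagonal matrices. -/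
def 𝔨 : Submodule ℂ (G p q) where
  carrier := {X | ∀ i j, X (Sum.inl i) (Sum.inr j) = 0 ∧ X (Sum.inr i) (Sum.inl j) = 0}
  zero_mem' := fun _ _ => ⟨rfl, rfl⟩
  add_mem' := fun {X Y} hX hY i j => by simp [(hX i j).1, (hX i j).2, (hY i j).1, (hY i j).2]
  smul_mem' := fun c X hX i j => by simp [(hX i j).1, (hX i j).2]

/-- `𝔮 = 𝔨 ⊕ 𝔭⁺`, the block upper triangular matrices. -/
def 𝔮 : Submodule ℂ (G p q) where
  carrier := {X | ∀ i j, X (Sum.inr i) (Sum.inl j) = 0}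
  zero_mem' := fun _ _ => rfl
  add_mem' := fun {X Y} hX hY i j => by simp [hX i j, hY i j]
  smul_mem' := fun c X hX i j => by simp [hX i j]

lemma isGraded_𝔮 : IsGraded (parity₂ p q) (𝔮 p q) := by
  intro X hX a i j
  simp [part, hX i j]

variable {p q}

/-- The upper left block. -/
def blk₁ : G p q →ₗ[ℂ] Matrix (Fin p ⊕ Fin q) (Fin p ⊕ Fin q) ℂ where
  toFun X := X.toBlocks₁₁
  map_add' _ _ := rfl
  map_smul' _ _ := rfl

/-- The lower right block. -/
def blk₂ : G p q →ₗ[ℂ] Matrix (Fin p ⊕ Fin q) (Fin p ⊕ Fin q) ℂ where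
  toFun X := X.toBlocks₂₂
  map_add' _ _ := rfl
  map_smul' _ _ := rfl

lemma blk₁_mem {a : ZMod 2} {X : G p q} (hX : X ∈ homog (parity₂ p q) a) :
    blk₁ X ∈ homog (parity p q) a := fun i j h => hX (Sum.inl i) (Sum.inl j) h

lemma blk₂_mem {a : ZMod 2} {X : G p q} (hX : X ∈ homog (parity₂ p q) a) :
    blk₂ X ∈ homog (parity p q) a := fun i j h => hX (Sum.inr i) (Sum.inr j) h

lemma blk₁_mul {X Y : G p q} (hY : Y ∈ 𝔮 p q) : blk₁ (X * Y) = blk₁ X * blk₁ Y := by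
  ext i j
  have h : ∀ k l, Y (Sum.inr k) (Sum.inl l) = 0 := hY
  simp [blk₁, Matrix.toBlocks₁₁, Matrix.mul_apply, h]

lemma blk₂_mul {X Y : G p q} (hX : X ∈ 𝔮 p q) : blk₂ (X * Y) = blk₂ X * blk₂ Y := by
  ext i j
  have h : ∀ k l, X (Sum.inr k) (Sum.inl l) = 0 := hX
  simp [blk₂, Matrix.toBlocks₂₂, Matrix.mul_apply, h]

lemma 𝔨_le_𝔮 : 𝔨 p q ≤ 𝔮 p q := fun _ hX i j => (hX i j).2

/-- The projection of `𝔮 = 𝔨 ⊕ 𝔭⁺` to `𝔨`. -/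
def levi : 𝔮 p q →ₗ[ℂ] 𝔨 p q where
  toFun X := ⟨Matrix.fromBlocks (blk₁ (X : G p q)) 0 0 (blk₂ (X : G p q)), fun _ _ => ⟨rfl, rfl⟩⟩
  map_add' X Y := by
    apply Subtype.ext
    change _ = Matrix.fromBlocks _ _ _ _ + Matrix.fromBlocks _ _ _ _
    rw [Matrix.fromBlocks_add]; simp
  map_smul' c X := by
    apply Subtype.ext
    change _ = c • Matrix.fromBlocks _ _ _ _
    rw [Matrix.fromBlocks_smul]; simp

lemma levi_mem {a : ZMod 2} {X : 𝔮 p q} (hX : (X : G p q) ∈ homog (parity₂ p q) a) :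
    (levi X : G p q) ∈ homog (parity₂ p q) a := by
  rintro (i | i) (j | j) h
  · exact hX _ _ h
  · rfl
  · rfl
  · exact hX _ _ h

section

variable {V V₁ V₂ : Type} [AddCommGroup V] [Module ℂ V]
  [AddCommGroup V₁] [Module ℂ V₁] [AddCommGroup V₂] [Module ℂ V₂]

/-- Extension of a `𝔨`-module to `𝔮`, with `𝔭⁺` acting by zero. -/
def inflate (M : SuperModule (parity₂ p q) (𝔨 p q) V) : SuperModule (parity₂ p q) (𝔮 p q) V where
  act := M.act ∘ₗ levi
  par := M.par
  par_par := M.par_par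
  par_act a X hX v := M.par_act a (levi X) (levi_mem hX) v
  act_bracket a b X Y Z hX hY hZ v := by
    refine M.act_bracket a b (levi X) (levi Y) (levi Z) (levi_mem hX) (levi_mem hY) ?_ v
    change Matrix.fromBlocks (blk₁ (Z : G p q)) 0 0 (blk₂ (Z : G p q)) =
      Matrix.fromBlocks (blk₁ (X : G p q)) 0 0 (blk₂ (X : G p q)) *
        Matrix.fromBlocks (blk₁ (Y : G p q)) 0 0 (blk₂ (Y : G p q)) -
      sgn a b • (Matrix.fromBlocks (blk₁ (Y : G p q)) 0 0 (blk₂ (Y : G p q)) *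
        Matrix.fromBlocks (blk₁ (X : G p q)) 0 0 (blk₂ (X : G p q)))
    rw [hZ, map_sub, map_sub, map_smul, map_smul, blk₁_mul Y.2, blk₁_mul X.2, blk₂_mul X.2,
      blk₂_mul Y.2, Matrix.fromBlocks_multiply, Matrix.fromBlocks_multiply,
      Matrix.fromBlocks_smul, sub_eq_add_neg (Matrix.fromBlocks _ _ _ _),
      Matrix.fromBlocks_neg, Matrix.fromBlocks_add]
    simp [sub_eq_add_neg]

/-- A supermatrix as an element of the full space of supermatrices. -/
abbrev full (X : Matrix (Fin p ⊕ Fin q) (Fin p ⊕ Fin q) ℂ) :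
    (⊤ : Submodule ℂ (Matrix (Fin p ⊕ Fin q) (Fin p ⊕ Fin q) ℂ)) := ⟨X, trivial⟩

lemma full_add (X Y : Matrix (Fin p ⊕ Fin q) (Fin p ⊕ Fin q) ℂ) :
    full (X + Y) = full X + full Y := rfl

lemma full_smul (c : ℂ) (X : Matrix (Fin p ⊕ Fin q) (Fin p ⊕ Fin q) ℂ) :
    full (c • X) = c • full X := rfl

/-- The action of `X = (X₁, X₂)` in `𝔨` on an outer tensor product:
`X (v ⊗ w) = X₁ v ⊗ w + (-1)^(|X₂||v|) v ⊗ X₂ w`. -/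
def outerAct (M : SuperModule (parity p q) ⊤ V₁) (N : SuperModule (parity p q) ⊤ V₂) :
    𝔨 p q →ₗ[ℂ] Module.End ℂ (V₁ ⊗[ℂ] V₂) where
  toFun X :=
    TensorProduct.map (M.act (full (blk₁ X))) LinearMap.id +
    TensorProduct.map LinearMap.id (N.act (full (part (parity p q) 0 (blk₂ X)))) +
    TensorProduct.map M.par (N.act (full (part (parity p q) 1 (blk₂ X))))
  map_add' X Y := by
    simp only [Submodule.coe_add, map_add, full_add, TensorProduct.map_add_left,
      TensorProduct.map_add_right]
    abel
  map_smul' c X := by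
    simp only [Submodule.coe_smul, map_smul, full_smul, TensorProduct.map_smul_left,
      TensorProduct.map_smul_right, smul_add, RingHom.id_apply]

lemma outerAct_tmul_zero (M : SuperModule (parity p q) ⊤ V₁) (N : SuperModule (parity p q) ⊤ V₂)
    {X : 𝔨 p q} (hX : (X : G p q) ∈ homog (parity₂ p q) 0) (v : V₁) (w : V₂) :
    outerAct M N X (v ⊗ₜ w) =
      M.act (full (blk₁ X)) v ⊗ₜ w + v ⊗ₜ N.act (full (blk₂ X)) w := by
  have h : full (0 : Matrix (Fin p ⊕ Fin q) (Fin p ⊕ Fin q) ℂ) = 0 := rfl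
  simp [outerAct, part_of_mem (blk₂_mem hX), h]

lemma outerAct_tmul_one (M : SuperModule (parity p q) ⊤ V₁) (N : SuperModule (parity p q) ⊤ V₂)
    {X : 𝔨 p q} (hX : (X : G p q) ∈ homog (parity₂ p q) 1) (v : V₁) (w : V₂) :
    outerAct M N X (v ⊗ₜ w) =
      M.act (full (blk₁ X)) v ⊗ₜ w + M.par v ⊗ₜ N.act (full (blk₂ X)) w := by
  have h : full (0 : Matrix (Fin p ⊕ Fin q) (Fin p ⊕ Fin q) ℂ) = 0 := rfl
  simp [outerAct, part_of_mem (blk₂_mem hX), h]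

/-- The outer tensor product of two `gl(p|q)`-modules, a module over
`𝔨 = gl(p|q) ⊕ gl(p|q)`. -/
def outer (M : SuperModule (parity p q) ⊤ V₁) (N : SuperModule (parity p q) ⊤ V₂) :
    SuperModule (parity₂ p q) (𝔨 p q) (V₁ ⊗[ℂ] V₂) where
  act := outerAct M N
  par := TensorProduct.map M.par N.par
  par_par z := by
    induction z using TensorProduct.induction_on with
    | zero => simp
    | tmul v w => simp [M.par_par, N.par_par]
    | add x y hx hy => simp [hx, hy]
  par_act a X hX z := by
    have h2 : ∀ a : ZMod 2, a = 0 ∨ a = 1 := by decide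
    have hM := M.par_act a (full (blk₁ X)) (blk₁_mem hX)
    have hN := N.par_act a (full (blk₂ X)) (blk₂_mem hX)
    induction z using TensorProduct.induction_on with
    | zero => simp
    | tmul v w =>
      rcases h2 a with rfl | rfl
      · rw [outerAct_tmul_zero M N hX, TensorProduct.map_tmul, outerAct_tmul_zero M N hX]
        simp [hM, hN, sgn]
      · rw [outerAct_tmul_one M N hX, TensorProduct.map_tmul, outerAct_tmul_one M N hX]
        simp [hM, hN, sgn, TensorProduct.neg_tmul, TensorProduct.tmul_neg]
    | add x y hx hy => rw [map_add, map_add, hx, hy, map_add, map_add, smul_add]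
  act_bracket a b X Y Z hX hY hZ z := by
    have h2 : ∀ a : ZMod 2, a = 0 ∨ a = 1 := by decide
    have hXq := 𝔨_le_𝔮 X.2
    have hYq := 𝔨_le_𝔮 Y.2
    have hZh : (Z : G p q) ∈ homog (parity₂ p q) (a + b) := by
      rw [hZ]
      exact Submodule.sub_mem _ (homog_mul hX hY)
        (Submodule.smul_mem _ _ (by rw [add_comm]; exact homog_mul hY hX))
    have hM := M.act_bracket a b (full (blk₁ X)) (full (blk₁ Y)) (full (blk₁ Z))
      (blk₁_mem hX) (blk₁_mem hY)
      (by change blk₁ _ = _; rw [hZ, map_sub, map_smul, blk₁_mul hYq, blk₁_mul hXq])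
    have hN := N.act_bracket a b (full (blk₂ X)) (full (blk₂ Y)) (full (blk₂ Z))
      (blk₂_mem hX) (blk₂_mem hY)
      (by change blk₂ _ = _; rw [hZ, map_sub, map_smul, blk₂_mul hXq, blk₂_mul hYq])
    have pX := M.par_act a (full (blk₁ X)) (blk₁_mem hX)
    have pY := M.par_act b (full (blk₁ Y)) (blk₁_mem hY)
    have h11 : (1 : ZMod 2) + 1 = 0 := by decide
    induction z using TensorProduct.induction_on with
    | zero => simp
    | tmul v w =>
      rcases h2 a with rfl | rfl <;> rcases h2 b with rfl | rfl
      · rw [add_zero] at hZh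
        simp only [outerAct_tmul_zero M N hX, outerAct_tmul_zero M N hY,
          outerAct_tmul_zero M N hZh, map_add, hM, hN, pX, pY, sgn_zero_left, one_smul,
          TensorProduct.sub_tmul, TensorProduct.tmul_sub]
        abel
      · rw [zero_add] at hZh
        simp only [outerAct_tmul_zero M N hX, outerAct_tmul_one M N hY,
          outerAct_tmul_one M N hZh, map_add, hM, hN, pX, pY, sgn_zero_left, one_smul,
          TensorProduct.sub_tmul, TensorProduct.tmul_sub]
        abel
      · rw [add_zero] at hZh
        simp only [outerAct_tmul_one M N hX, outerAct_tmul_zero M N hY,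
          outerAct_tmul_one M N hZh, map_add, hM, hN, pX, pY, sgn_zero_left, one_smul,
          sgn_comm 1 0, TensorProduct.sub_tmul, TensorProduct.tmul_sub]
        abel
      · rw [h11] at hZh
        simp only [outerAct_tmul_one M N hX, outerAct_tmul_one M N hY,
          outerAct_tmul_zero M N hZh, map_add, hM, hN, pX, pY, M.par_par, sgn_one_one,
          neg_smul, one_smul, sub_neg_eq_add,
          TensorProduct.add_tmul, TensorProduct.tmul_add, TensorProduct.neg_tmul]
        abel
    | add x y hx hy =>
      simp only [map_add, hx, hy, smul_add]
      abel

end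

/-! ### Hook partitions and the modules `W_λ`, `I_λ` -/

/-- The weight `λ^♮ = (λ₁, …, λ_p, ⟨λ'₁ - p⟩, …, ⟨λ'_q - p⟩)` with `⟨x⟩ = max x 0`. -/
def natWeight (lam : YoungDiagram) : Fin p ⊕ Fin q → ℂ :=
  Sum.elim (fun i => (lam.rowLen i : ℂ)) (fun j => ((lam.colLen j - p : ℕ) : ℂ))

variable (p q)

/-- `(p, q)`-hook partitions: `λ_{p+1} ≤ q` (rows are numbered from `0`). -/
def IsHook (lam : YoungDiagram) : Prop := lam.rowLen p ≤ q

/-- The `𝔨`-module `W_λ = L(λ^♮) ⊗ L(λ^♮)^*`. -/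
def W (lam : YoungDiagram) : SuperModule (parity₂ p q) (𝔨 p q)
    (LSpace (natWeight (p := p) (q := q) lam) ⊗[ℂ] LSpace (natWeight (p := p) (q := q) lam)) :=
  outer (L (natWeight lam)) (L (natWeight lam)).contragredient

/-- The generalized Verma module `I_λ`, induced from `W_λ` extended to `𝔮 = 𝔨 ⊕ 𝔭⁺` by the zero
action of `𝔭⁺`. -/
def I (lam : YoungDiagram) : SuperModule (parity₂ p q) ⊤ (inflate (W p q lam)).IndSpace :=
  (inflate (W p q lam)).Ind (isGraded_𝔮 p q)

end Pair

end SuperPair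

/-!
Since `𝔭⁻` is an abelian complement of `𝔮` in `𝔤`, the Poincaré–Birkhoff–Witt theorem identifies
`I_λ` with `S(𝔭⁻) ⊗ W_λ`. This is made explicit by letting `𝔤` act on `S(𝔭⁻) ⊗ V` for every
`𝔮`-module `V`: the induced map `I → S(𝔭⁻) ⊗ V` has a left inverse and is therefore injective.

A non-zero homomorphism `W_μ → I_λ`, evaluated at the highest weight vector of the first factor,
yields a non-zero vector `w` of `S(𝔭⁻) ⊗ W_λ` which is singular of weight `μ^♮` for the upper left
copy of `𝔤𝔩(p|q)`. Grade `S(𝔭⁻)` by a height of the columns such that a raising operator strictly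
increases the degree when it acts on `S(𝔭⁻)` and preserves it when it acts on `W_λ`. Then the
component of `w` of least degree is killed by the raising operators acting on `W_λ` alone, and
the singular vectors of `L(λ^♮)` are the multiples of its highest weight vector. So the weight of
this component is `λ^♮` minus the number of factors from `𝔭⁻` in each column. Hence
`λ^♮ - μ^♮` has coordinates in `ℕ`, which for hook partitions forces `λ ⊇ μ`.
-/

namespace SuperPair

/-! ### Eigenspaces along `y + ℕ` -/

section Eigenspaces

variable {K V : Type*} [Field K] [AddCommGroup V] [Module K V] {T A : Module.End K V} {x y : K}

/-- The sum of the eigenspaces of `T` with eigenvalues in `y + ℕ`. If the eigenvalues of `T` are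
degrees, this is the part of degree at least `y`. -/
def eigenspaceFrom (T : Module.End K V) (y : K) : Submodule K V :=
  ⨆ n : ℕ, T.eigenspace (y + n)

lemma mem_eigenspaceFrom {v : V} (n : ℕ) (hv : T v = (y + n) • v) : v ∈ eigenspaceFrom T y :=
  Submodule.mem_iSup_of_mem n (Module.End.mem_eigenspace_iff.2 hv)

lemma eigenspaceFrom_add_natCast_le (T : Module.End K V) (y : K) (k : ℕ) :
    eigenspaceFrom T (y + k) ≤ eigenspaceFrom T y :=
  iSup_le fun n _ hv => mem_eigenspaceFrom (k + n) <| by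
    rw [Nat.cast_add, ← add_assoc]
    exact Module.End.mem_eigenspace_iff.1 hv

lemma eigenspace_le_comap_of_lie_eq_smul {c : K} (h : ⁅T, A⁆ = c • A) (x : K) :
    T.eigenspace x ≤ (T.eigenspace (x + c)).comap A := fun v hv => by
  have hTA : T (A v) - A (T v) = c • A v := LinearMap.congr_fun h v
  rw [Module.End.mem_eigenspace_iff] at hv
  rw [Submodule.mem_comap, Module.End.mem_eigenspace_iff, eq_add_of_sub_eq hTA, hv, map_smul,
    add_smul, add_comm]

lemma eigenspaceFrom_le_comap_of_lie_eq_smul {k : ℕ} (h : ⁅T, A⁆ = (k : K) • A) (y : K) :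
    eigenspaceFrom T y ≤ (eigenspaceFrom T (y + k)).comap A :=
  iSup_le fun n v hv => mem_eigenspaceFrom n <| by
    rw [add_right_comm]
    exact Module.End.mem_eigenspace_iff.1 (eigenspace_le_comap_of_lie_eq_smul h _ hv)

lemma eigenspaceFrom_le_comap_of_lie_eq_zero (h : ⁅T, A⁆ = 0) (y : K) :
    eigenspaceFrom T y ≤ (eigenspaceFrom T y).comap A := by
  simpa using eigenspaceFrom_le_comap_of_lie_eq_smul (k := 0) (h.trans (by simp)) y

lemma exists_eq_add_natCast_of_mem_eigenspaceFrom {v : V} (hv : v ∈ eigenspaceFrom T y)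
    (hv₀ : v ≠ 0) (hTv : T v = x • v) : ∃ n : ℕ, x = y + n := by
  by_contra! hx
  refine hv₀ ((Submodule.disjoint_def.1 (T.eigenspaces_iSupIndep x)) v
    (Module.End.mem_eigenspace_iff.2 hTv) ?_)
  have hle : eigenspaceFrom T y ≤ ⨆ (z) (_ : z ≠ x), T.eigenspace z :=
    iSup_le fun n => le_iSup₂_of_le (y + n) (hx n).symm le_rfl
  exact hle hv

lemma eq_zero_of_mem_eigenspaceFrom_add_one [CharZero K] {v : V} (hTv : T v = x • v)
    (hv : v ∈ eigenspaceFrom T (x + 1)) : v = 0 := by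
  by_contra hv₀
  obtain ⟨n, hn⟩ := exists_eq_add_natCast_of_mem_eigenspaceFrom hv hv₀ hTv
  rw [add_assoc, left_eq_add] at hn
  exact Nat.cast_add_one_ne_zero n (by rwa [add_comm] at hn)

lemma exists_leading_component {w : V} (hw : w ∈ eigenspaceFrom T y) (hw₀ : w ≠ 0) :
    ∃ n : ℕ, ∃ w₀ ≠ 0, T w₀ = (y + n) • w₀ ∧ w - w₀ ∈ eigenspaceFrom T (y + n + 1) := by
  obtain ⟨f, hf, rfl⟩ := (Submodule.mem_iSup_iff_exists_finsupp _ _).1 hw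
  have hsupp : f.support.Nonempty := by
    rw [Finsupp.support_nonempty_iff]
    rintro rfl
    exact hw₀ Finsupp.sum_zero_index
  set n := f.support.min' hsupp with hn
  have hnf : n ∈ f.support := f.support.min'_mem hsupp
  refine ⟨n, f n, Finsupp.mem_support_iff.1 hnf, Module.End.mem_eigenspace_iff.1 (hf n), ?_⟩
  rw [Finsupp.sum, ← Finset.add_sum_erase _ _ hnf, add_sub_cancel_left]
  refine Submodule.sum_mem _ fun m hm => ?_
  obtain ⟨k, rfl⟩ := Nat.exists_eq_add_of_lt (f.support.min'_lt_of_mem_erase_min' hsupp hm)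
  refine mem_eigenspaceFrom k ((Module.End.mem_eigenspace_iff.1 (hf _)).trans ?_)
  rw [← hn]
  push_cast
  congr 1
  ring

lemma apply_leading_component_eq_zero [CharZero K] (hTA : ⁅T, A⁆ = 0) {w w₀ : V}
    (hTw₀ : T w₀ = x • w₀) (hw : w - w₀ ∈ eigenspaceFrom T (x + 1))
    (hAw : A w ∈ eigenspaceFrom T (x + 1)) : A w₀ = 0 := by
  refine eq_zero_of_mem_eigenspaceFrom_add_one (T := T) (x := x) ?_ ?_
  · rw [← sub_eq_zero, ← map_smul, ← hTw₀]
    exact LinearMap.congr_fun hTA w₀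
  · have := Submodule.sub_mem _ hAw (eigenspaceFrom_le_comap_of_lie_eq_zero hTA _ hw)
    rwa [← map_sub, sub_sub_cancel] at this

lemma apply_leading_component_eq_smul [CharZero K] (hTA : ⁅T, A⁆ = 0) {w w₀ : V}
    (hTw₀ : T w₀ = x • w₀) (hw : w - w₀ ∈ eigenspaceFrom T (x + 1)) {z : K}
    (hAw : A w = z • w) : A w₀ = z • w₀ := by
  have hlie : ⁅T, A - z • 1⁆ = 0 := commute_iff_lie_eq.1 <|
    (commute_iff_lie_eq.2 hTA).sub_right ((Commute.one_right T).smul_right z)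
  refine sub_eq_zero.1 (apply_leading_component_eq_zero (A := A - z • 1) hlie hTw₀ hw ?_)
  rw [LinearMap.sub_apply, hAw, LinearMap.smul_apply, Module.End.one_apply, sub_self]
  exact zero_mem _

end Eigenspaces

section Kernels

variable {K V W X : Type*} {I : Type*} {Y : I → Type*} [Field K] [AddCommGroup V] [Module K V]
  [AddCommGroup W] [Module K W] [AddCommGroup X] [Module K X]
  [∀ i, AddCommGroup (Y i)] [∀ i, Module K (Y i)]

lemma equivFinsuppOfBasisLeft_lTensor {J : Type*} [DecidableEq J] (b : Module.Basis J K X)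
    (f : V →ₗ[K] W) (t : X ⊗[K] V) (j : J) :
    TensorProduct.equivFinsuppOfBasisLeft b (f.lTensor X t) j =
      f (TensorProduct.equivFinsuppOfBasisLeft b t j) := by
  induction t using TensorProduct.induction_on with
  | zero => simp only [map_zero, Finsupp.coe_zero, Pi.zero_apply]
  | tmul x v =>
    simp only [LinearMap.lTensor_tmul, TensorProduct.equivFinsuppOfBasisLeft_apply_tmul_apply,
      map_smul]
  | add s t hs ht => simp only [map_add, Finsupp.add_apply, hs, ht]

variable (X) in
lemma iInf_ker_lTensor_le {φ : ∀ i, V →ₗ[K] Y i} {θ : V →ₗ[K] W}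
    (h : ⨅ i, LinearMap.ker (φ i) ≤ LinearMap.ker θ) :
    ⨅ i, LinearMap.ker ((φ i).lTensor X) ≤ LinearMap.ker (θ.lTensor X) := fun t ht => by
  classical
  let b := Module.Basis.ofVectorSpace K X
  rw [LinearMap.mem_ker, ← (TensorProduct.equivFinsuppOfBasisLeft b).map_eq_zero_iff]
  ext j
  rw [equivFinsuppOfBasisLeft_lTensor]
  refine h ((Submodule.mem_iInf _).2 fun i => ?_)
  rw [LinearMap.mem_ker, ← equivFinsuppOfBasisLeft_lTensor,
    LinearMap.mem_ker.1 ((Submodule.mem_iInf _).1 ht i), map_zero, Finsupp.coe_zero, Pi.zero_apply]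

lemma rTensor_eq_zero_iff (f : V →ₗ[K] W) (t : V ⊗[K] X) :
    f.rTensor X t = 0 ↔ f.lTensor X (TensorProduct.comm K V X t) = 0 := by
  rw [← LinearMap.comm_comp_rTensor_comp_comm_eq]
  simp

variable (X) in
lemma iInf_ker_rTensor_le {φ : ∀ i, V →ₗ[K] Y i} {θ : V →ₗ[K] W}
    (h : ⨅ i, LinearMap.ker (φ i) ≤ LinearMap.ker θ) :
    ⨅ i, LinearMap.ker ((φ i).rTensor X) ≤ LinearMap.ker (θ.rTensor X) := fun t ht => by
  rw [LinearMap.mem_ker, rTensor_eq_zero_iff]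
  refine iInf_ker_lTensor_le X h ?_
  simpa only [Submodule.mem_iInf, LinearMap.mem_ker, rTensor_eq_zero_iff] using ht

end Kernels

/-! ### Supercommutators -/

lemma sgn_add_right (a b c : ZMod 2) : sgn a (b + c) = sgn a b * sgn a c := by
  rw [sgn_comm, sgn_add, sgn_comm b, sgn_comm c]

lemma sgn_ne_zero (a b : ZMod 2) : sgn a b ≠ 0 := left_ne_zero_of_mul_eq_one (sgn_mul_self a b)

section Supercommutators

variable {ι : Type} [Fintype ι] {π : ι → ZMod 2} {a b c : ZMod 2} {X Y Z : Matrix ι ι ℂ}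

/-- The supercommutator `[X, Y]` of supermatrices `X` and `Y` of parities `a` and `b`. The parities
are explicit arguments, so that the formula makes sense for all matrices. -/
abbrev sbracket (a b : ZMod 2) (X Y : Matrix ι ι ℂ) : Matrix ι ι ℂ := X * Y - sgn a b • (Y * X)

lemma sbracket_mem (hX : X ∈ homog π a) (hY : Y ∈ homog π b) :
    sbracket a b X Y ∈ homog π (a + b) :=
  Submodule.sub_mem _ (homog_mul hX hY)
    (Submodule.smul_mem _ _ (add_comm b a ▸ homog_mul hY hX))

lemma sbracket_swap (a b : ZMod 2) (X Y : Matrix ι ι ℂ) :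
    sbracket a b X Y = -(sgn a b • sbracket b a Y X) := by
  match_scalars
  · linear_combination -sgn_mul_self a b + sgn a b * sgn_comm a b
  · ring

lemma sbracket_jacobi (a b c : ZMod 2) (X Y Z : Matrix ι ι ℂ) :
    sbracket (a + b) c (sbracket a b X Y) Z =
      sbracket a (b + c) X (sbracket b c Y Z) +
        sgn b c • sbracket (a + c) b (sbracket a c X Z) Y := by
  simp only [sbracket, sub_mul, mul_sub, smul_mul_assoc, mul_smul_comm, mul_assoc, sgn_add,
    sgn_add_right, sgn_comm c b]
  rcases mul_self_eq_one_iff.1 (sgn_mul_self b c) with h | h <;> simp only [h] <;> module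

lemma linearMap_eq_of_homog (π : ι → ZMod 2) {V : Type*} [AddCommGroup V] [Module ℂ V]
    {f g : Matrix ι ι ℂ →ₗ[ℂ] V} (h : ∀ a, ∀ X ∈ homog π a, f X = g X) : f = g := by
  ext1 X
  rw [← part_add_part π X, map_add, map_add, h 0 _ (part_mem π 0 X), h 1 _ (part_mem π 1 X)]

/-- The map `X ↦ (-1)^(|X| b) X`, which moves a symbol of parity `b` past `X`. -/
def twist (π : ι → ZMod 2) (b : ZMod 2) : Matrix ι ι ℂ →ₗ[ℂ] Matrix ι ι ℂ :=
  part π 0 + sgn 1 b • part π 1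

lemma twist_of_mem (hX : X ∈ homog π a) (b : ZMod 2) : twist π b X = sgn a b • X := by
  have zero_or_one : ∀ a : ZMod 2, a = 0 ∨ a = 1 := by decide
  rcases zero_or_one a with rfl | rfl <;> simp [twist, part_of_mem hX, sgn_zero_left]

end Supercommutators

/-! ### The supersymmetric algebra -/

section SuperSymmetric

variable {ι : Type} {π : ι → ZMod 2} {𝔮 : Submodule ℂ (Matrix ι ι ℂ)}

/-- The defining relations of `SuperSym π 𝔮`: supercommutativity, and the vanishing of `𝔮`. -/
inductive SymRel (π : ι → ZMod 2) (𝔮 : Submodule ℂ (Matrix ι ι ℂ)) :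
    TensorAlgebra ℂ (Matrix ι ι ℂ) → TensorAlgebra ℂ (Matrix ι ι ℂ) → Prop
  | comm (a b : ZMod 2) (X Y : Matrix ι ι ℂ) (hX : X ∈ homog π a) (hY : Y ∈ homog π b) :
    SymRel π 𝔮 (TensorAlgebra.ι ℂ X * TensorAlgebra.ι ℂ Y)
      (sgn a b • (TensorAlgebra.ι ℂ Y * TensorAlgebra.ι ℂ X))
  | zero (X : Matrix ι ι ℂ) (hX : X ∈ 𝔮) : SymRel π 𝔮 (TensorAlgebra.ι ℂ X) 0

/-- The supersymmetric algebra `S(𝔤/𝔮)` of the quotient of the space `𝔤` of all supermatrices by a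
subspace `𝔮`. -/
def SuperSym (π : ι → ZMod 2) (𝔮 : Submodule ℂ (Matrix ι ι ℂ)) : Type := RingQuot (SymRel π 𝔮)

instance : Ring (SuperSym π 𝔮) := inferInstanceAs (Ring (RingQuot (SymRel π 𝔮)))

instance : Algebra ℂ (SuperSym π 𝔮) := inferInstanceAs (Algebra ℂ (RingQuot (SymRel π 𝔮)))

namespace SuperSym

/-- The quotient map from the tensor algebra. -/
def mk (π : ι → ZMod 2) (𝔮 : Submodule ℂ (Matrix ι ι ℂ)) :
    TensorAlgebra ℂ (Matrix ι ι ℂ) →ₐ[ℂ] SuperSym π 𝔮 :=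
  RingQuot.mkAlgHom ℂ (SymRel π 𝔮)

lemma mk_surjective : Function.Surjective (mk π 𝔮) :=
  RingQuot.mkAlgHom_surjective ℂ (SymRel π 𝔮)

/-- The image of a supermatrix in the supersymmetric algebra. -/
def gen (π : ι → ZMod 2) (𝔮 : Submodule ℂ (Matrix ι ι ℂ)) :
    Matrix ι ι ℂ →ₗ[ℂ] SuperSym π 𝔮 :=
  (mk π 𝔮).toLinearMap ∘ₗ TensorAlgebra.ι ℂ

lemma gen_mul_gen {a b : ZMod 2} {X Y : Matrix ι ι ℂ} (hX : X ∈ homog π a)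
    (hY : Y ∈ homog π b) : gen π 𝔮 X * gen π 𝔮 Y = sgn a b • (gen π 𝔮 Y * gen π 𝔮 X) := by
  have h : mk π 𝔮 _ = mk π 𝔮 _ := RingQuot.mkAlgHom_rel ℂ (SymRel.comm a b X Y hX hY)
  rwa [map_smul, map_mul, map_mul] at h

lemma gen_eq_zero {X : Matrix ι ι ℂ} (hX : X ∈ 𝔮) : gen π 𝔮 X = 0 := by
  have h : mk π 𝔮 _ = mk π 𝔮 _ := RingQuot.mkAlgHom_rel ℂ (SymRel.zero X hX)
  rwa [map_zero] at h

/-- The universal property of the supersymmetric algebra. -/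
def lift {B : Type*} [Semiring B] [Algebra ℂ B] (g : Matrix ι ι ℂ →ₗ[ℂ] B)
    (hcomm : ∀ a b, ∀ X ∈ homog π a, ∀ Y ∈ homog π b, g X * g Y = sgn a b • (g Y * g X))
    (hzero : ∀ X ∈ 𝔮, g X = 0) : SuperSym π 𝔮 →ₐ[ℂ] B :=
  RingQuot.liftAlgHom ℂ ⟨TensorAlgebra.lift ℂ g, by
    rintro _ _ (⟨a, b, X, Y, hX, hY⟩ | ⟨X, hX⟩)
    · simpa only [map_smul, map_mul, TensorAlgebra.lift_ι_apply] using hcomm a b X hX Y hY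
    · simpa only [map_zero, TensorAlgebra.lift_ι_apply] using hzero X hX⟩

lemma lift_gen {B : Type*} [Semiring B] [Algebra ℂ B] (g : Matrix ι ι ℂ →ₗ[ℂ] B)
    (hcomm : ∀ a b, ∀ X ∈ homog π a, ∀ Y ∈ homog π b, g X * g Y = sgn a b • (g Y * g X))
    (hzero : ∀ X ∈ 𝔮, g X = 0) (X : Matrix ι ι ℂ) :
    lift g hcomm hzero (gen π 𝔮 X) = g X :=
  (RingQuot.liftAlgHom_mkAlgHom_apply ℂ _ _ _).trans (TensorAlgebra.lift_ι_apply g X)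

variable {V : Type*} [AddCommGroup V] [Module ℂ V]

/-- The generators of the supersymmetric algebra acting by left multiplication. -/
def genAct (π : ι → ZMod 2) (𝔮 : Submodule ℂ (Matrix ι ι ℂ)) (V : Type*)
    [AddCommGroup V] [Module ℂ V] : Matrix ι ι ℂ →ₗ[ℂ] Module.End ℂ (SuperSym π 𝔮 ⊗[ℂ] V) :=
  (Algebra.lsmul ℂ ℂ (SuperSym π 𝔮 ⊗[ℂ] V)).toLinearMap ∘ₗ gen π 𝔮

lemma genAct_apply (X : Matrix ι ι ℂ) (t : SuperSym π 𝔮 ⊗[ℂ] V) :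
    genAct π 𝔮 V X t = gen π 𝔮 X • t := rfl

lemma genAct_mul_genAct {a b : ZMod 2} {X Y : Matrix ι ι ℂ} (hX : X ∈ homog π a)
    (hY : Y ∈ homog π b) :
    genAct π 𝔮 V X * genAct π 𝔮 V Y = sgn a b • (genAct π 𝔮 V Y * genAct π 𝔮 V X) :=
  LinearMap.ext fun t => by
    simp only [Module.End.mul_apply, LinearMap.smul_apply, genAct_apply]
    rw [← mul_smul, gen_mul_gen hX hY, smul_assoc, mul_smul]

variable [Fintype ι]

lemma mk_smul_induction {T : Type*} [AddCommGroup T] [Module ℂ T] [Module (SuperSym π 𝔮) T]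
    [IsScalarTower ℂ (SuperSym π 𝔮) T] {motive : T → Prop}
    (add : ∀ s t, motive s → motive t → motive (s + t))
    (smul : ∀ (c : ℂ) (t), motive t → motive (c • t))
    (gen_smul : ∀ b, ∀ Y ∈ homog π b, ∀ t, motive t → motive (gen π 𝔮 Y • t))
    (u : TensorAlgebra ℂ (Matrix ι ι ℂ)) (t : T) (ht : motive t) : motive (mk π 𝔮 u • t) := by
  induction u using TensorAlgebra.induction generalizing t with
  | algebraMap r =>
    rw [AlgHom.commutes, algebraMap_smul]
    exact smul r t ht
  | ι X =>
    change motive (gen π 𝔮 X • t)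
    rw [← part_add_part π X, map_add, add_smul]
    exact add _ _ (gen_smul 0 _ (part_mem π 0 X) t ht) (gen_smul 1 _ (part_mem π 1 X) t ht)
  | mul x y hx hy =>
    rw [map_mul, mul_smul]
    exact hx _ (hy t ht)
  | add x y hx hy =>
    rw [map_add, add_smul]
    exact add _ _ (hx t ht) (hy t ht)

@[elab_as_elim]
lemma tensor_induction {motive : SuperSym π 𝔮 ⊗[ℂ] V → Prop} (t : SuperSym π 𝔮 ⊗[ℂ] V)
    (one_tmul : ∀ v, motive (1 ⊗ₜ v))
    (add : ∀ s t, motive s → motive t → motive (s + t))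
    (smul : ∀ (c : ℂ) (t), motive t → motive (c • t))
    (gen_smul : ∀ b, ∀ Y ∈ homog π b, ∀ t, motive t → motive (gen π 𝔮 Y • t)) : motive t := by
  induction t using TensorProduct.induction_on with
  | zero => simpa using smul 0 _ (one_tmul 0)
  | tmul u v =>
    obtain ⟨u, rfl⟩ := mk_surjective u
    have hu := mk_smul_induction add smul gen_smul u _ (one_tmul v)
    rwa [TensorProduct.smul_tmul', smul_eq_mul, mul_one] at hu
  | add x y hx hy => exact add _ _ hx hy

lemma tensor_linearMap_eq {V' : Type*} [AddCommGroup V'] [Module ℂ V']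
    {f g : SuperSym π 𝔮 ⊗[ℂ] V →ₗ[ℂ] V'} (one_tmul : ∀ v, f (1 ⊗ₜ v) = g (1 ⊗ₜ v))
    (gen_smul : ∀ b, ∀ Y ∈ homog π b, ∀ t, f t = g t →
      f (gen π 𝔮 Y • t) = g (gen π 𝔮 Y • t)) : f = g := by
  refine LinearMap.ext fun t => ?_
  induction t using tensor_induction with
  | one_tmul v => exact one_tmul v
  | add s t hs ht => rw [map_add, map_add, hs, ht]
  | smul c t ht => rw [map_smul, map_smul, ht]
  | gen_smul b Y hY t ht => exact gen_smul b Y hY t ht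

end SuperSym

end SuperSymmetric

/-! ### The action on the tensor product of the supersymmetric algebra and a module -/

/-- `d` is the projection along the graded subsuperalgebra `𝔮` of the supermatrices onto a
complement of `𝔮` whose elements supercommute. -/
structure IsAbelianProjection {ι : Type} [Fintype ι] (π : ι → ZMod 2)
    (𝔮 : Submodule ℂ (Matrix ι ι ℂ)) (d : Matrix ι ι ℂ →ₗ[ℂ] Matrix ι ι ℂ) : Prop where
  sub_mem : ∀ X, X - d X ∈ 𝔮
  eq_zero : ∀ X ∈ 𝔮, d X = 0
  isGraded : IsGraded π 𝔮
  homog_mem : ∀ a, ∀ X ∈ homog π a, d X ∈ homog π a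
  sbracket_eq_zero : ∀ a b, ∀ X ∈ homog π a, ∀ Y ∈ homog π b, sbracket a b (d X) (d Y) = 0
  sbracket_mem : ∀ a b, ∀ X ∈ 𝔮 ⊓ homog π a, ∀ Y ∈ 𝔮 ⊓ homog π b, sbracket a b X Y ∈ 𝔮

section Step

variable {ι : Type} [Fintype ι] {π : ι → ZMod 2} {𝔮 : Submodule ℂ (Matrix ι ι ℂ)}
  {d : Matrix ι ι ℂ →ₗ[ℂ] Matrix ι ι ℂ} {N : Type*} [AddCommGroup N] [Module ℂ N]
  {g : Matrix ι ι ℂ →ₗ[ℂ] Module.End ℂ N}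

/-- The part of `actStep` coming from the component of parity `b`. -/
def actStepPart (π : ι → ZMod 2) (d : Matrix ι ι ℂ →ₗ[ℂ] Matrix ι ι ℂ)
    (g : Matrix ι ι ℂ →ₗ[ℂ] Module.End ℂ N) (b : ZMod 2) :
    Matrix ι ι ℂ →ₗ[ℂ] Module.End ℂ (Matrix ι ι ℂ →ₗ[ℂ] N) :=
  LinearMap.mk₂ ℂ (fun Y R => R ∘ₗ LinearMap.mulRight ℂ (d (part π b Y)) -
      R ∘ₗ LinearMap.mulLeft ℂ (d (part π b Y)) ∘ₗ twist π b + g (part π b Y) ∘ₗ R ∘ₗ twist π b)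
    (fun Y Y' R => LinearMap.ext fun X => by
      simp only [map_add, LinearMap.add_apply, LinearMap.sub_apply, LinearMap.comp_apply,
        LinearMap.mulRight_apply, LinearMap.mulLeft_apply, mul_add, add_mul]
      abel)
    (fun c Y R => by ext1 X; simp [smul_add, smul_sub])
    (fun Y R R' => LinearMap.ext fun X => by
      simp only [map_add, LinearMap.add_apply, LinearMap.sub_apply, LinearMap.comp_apply]
      abel)
    (fun c Y R => by ext1 X; simp [smul_add, smul_sub])

/-- If `R X` is the action of `X` on a vector `t`, then `actStep π d g Y R X` is the action of `X`
on the product of `d Y` and `t`, where `g` gives the action of the range of `d`. -/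
def actStep (π : ι → ZMod 2) (d : Matrix ι ι ℂ →ₗ[ℂ] Matrix ι ι ℂ)
    (g : Matrix ι ι ℂ →ₗ[ℂ] Module.End ℂ N) :
    Matrix ι ι ℂ →ₗ[ℂ] Module.End ℂ (Matrix ι ι ℂ →ₗ[ℂ] N) :=
  actStepPart π d g 0 + actStepPart π d g 1

lemma actStep_apply {c b : ZMod 2} {X Y : Matrix ι ι ℂ} (hX : X ∈ homog π c)
    (hY : Y ∈ homog π b) (R : Matrix ι ι ℂ →ₗ[ℂ] N) :
    actStep π d g Y R X = R (sbracket c b X (d Y)) + sgn c b • g Y (R X) := by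
  have zero_or_one : ∀ a : ZMod 2, a = 0 ∨ a = 1 := by decide
  rcases zero_or_one b with rfl | rfl <;>
    simp [actStep, actStepPart, part_of_mem hY, twist_of_mem hX]

lemma actStep_mul_actStep (hd : IsAbelianProjection π 𝔮 d)
    (hg : ∀ a b, ∀ X ∈ homog π a, ∀ Y ∈ homog π b, g X * g Y = sgn a b • (g Y * g X))
    {a b : ZMod 2} {Y Z : Matrix ι ι ℂ} (hY : Y ∈ homog π a) (hZ : Z ∈ homog π b) :
    actStep π d g Y * actStep π d g Z = sgn a b • (actStep π d g Z * actStep π d g Y) := by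
  refine LinearMap.ext fun R => linearMap_eq_of_homog π fun c X hX => ?_
  have hXY := sbracket_mem hX (hd.homog_mem a Y hY)
  have hXZ := sbracket_mem hX (hd.homog_mem b Z hZ)
  have brackets_comm : sbracket (c + a) b (sbracket c a X (d Y)) (d Z) =
      sgn a b • sbracket (c + b) a (sbracket c b X (d Z)) (d Y) := by
    rw [sbracket_jacobi, hd.sbracket_eq_zero a b Y hY Z hZ]
    simp [sbracket]
  have hgYZ : g Y (g Z (R X)) = sgn a b • g Z (g Y (R X)) :=
    LinearMap.congr_fun (hg a b Y hY Z hZ) (R X)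
  rw [LinearMap.smul_apply, LinearMap.smul_apply, Module.End.mul_apply, Module.End.mul_apply,
    actStep_apply hX hY, actStep_apply hX hZ, actStep_apply hXY hZ, actStep_apply hX hZ,
    actStep_apply hX hY, actStep_apply hXZ hY, brackets_comm]
  simp only [map_add, map_smul, hgYZ, sgn_add, sgn_comm b a]
  rcases mul_self_eq_one_iff.1 (sgn_mul_self a b) with h | h <;> simp only [h] <;> module

end Step

namespace IsAbelianProjection

variable {ι : Type} [Fintype ι] {π : ι → ZMod 2} {𝔮 : Submodule ℂ (Matrix ι ι ℂ)}
  {d : Matrix ι ι ℂ →ₗ[ℂ] Matrix ι ι ℂ} {V : Type} [AddCommGroup V] [Module ℂ V]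

open SuperSym (gen gen_mul_gen gen_eq_zero genAct genAct_apply genAct_mul_genAct)

lemma map_map (hd : IsAbelianProjection π 𝔮 d) (X : Matrix ι ι ℂ) : d (d X) = d X := by
  have h := hd.eq_zero _ (hd.sub_mem X)
  rw [map_sub, sub_eq_zero] at h
  exact h.symm

lemma gen_map (hd : IsAbelianProjection π 𝔮 d) (X : Matrix ι ι ℂ) :
    gen π 𝔮 (d X) = gen π 𝔮 X := by
  have h := gen_eq_zero (π := π) (hd.sub_mem X)
  rw [map_sub, sub_eq_zero] at h
  exact h.symm

/-- The projection onto `𝔮` along the range of `d`. -/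
def toSub (hd : IsAbelianProjection π 𝔮 d) : Matrix ι ι ℂ →ₗ[ℂ] 𝔮 :=
  LinearMap.codRestrict 𝔮 (LinearMap.id - d) hd.sub_mem

lemma coe_toSub (hd : IsAbelianProjection π 𝔮 d) (X : Matrix ι ι ℂ) :
    (hd.toSub X : Matrix ι ι ℂ) = X - d X := rfl

lemma toSub_of_mem (hd : IsAbelianProjection π 𝔮 d) {X : Matrix ι ι ℂ} (hX : X ∈ 𝔮) :
    hd.toSub X = ⟨X, hX⟩ :=
  Subtype.ext <| by rw [coe_toSub, hd.eq_zero X hX, sub_zero]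

lemma toSub_map (hd : IsAbelianProjection π 𝔮 d) (X : Matrix ι ι ℂ) : hd.toSub (d X) = 0 :=
  Subtype.ext <| by rw [coe_toSub, hd.map_map, sub_self, Submodule.coe_zero]

lemma actStep_genAct_of_mem (hd : IsAbelianProjection π 𝔮 d) {X : Matrix ι ι ℂ} (hX : X ∈ 𝔮) :
    actStep π d (genAct π 𝔮 V) X = 0 := by
  have hpart (b : ZMod 2) : actStep π d (genAct π 𝔮 V) (part π b X) = 0 := by
    refine LinearMap.ext fun R => linearMap_eq_of_homog π fun c Z hZ => ?_
    rw [actStep_apply hZ (part_mem π b X), hd.eq_zero _ (hd.isGraded X hX b), genAct_apply,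
      gen_eq_zero (hd.isGraded X hX b)]
    simp [sbracket]
  rw [← part_add_part π X, map_add, hpart, hpart, add_zero]

/-- The action of the supersymmetric algebra on linear maps extending `actStep`. -/
def stepHom (hd : IsAbelianProjection π 𝔮 d) (V : Type) [AddCommGroup V] [Module ℂ V] :
    SuperSym π 𝔮 →ₐ[ℂ] Module.End ℂ (Matrix ι ι ℂ →ₗ[ℂ] SuperSym π 𝔮 ⊗[ℂ] V) :=
  SuperSym.lift (actStep π d (genAct π 𝔮 V))
    (fun _ _ _ hX _ hY => actStep_mul_actStep hd
      (fun _ _ _ hX _ hY => genAct_mul_genAct hX hY) hX hY)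
    (fun _ hX => hd.actStep_genAct_of_mem hX)

/-- The action of supermatrices on `1 ⊗ V`. -/
def actBase (hd : IsAbelianProjection π 𝔮 d) (M : SuperModule π 𝔮 V) :
    V →ₗ[ℂ] Matrix ι ι ℂ →ₗ[ℂ] SuperSym π 𝔮 ⊗[ℂ] V :=
  (TensorProduct.mk ℂ (SuperSym π 𝔮) V ∘ₗ gen π 𝔮 +
    (M.act ∘ₗ hd.toSub).compr₂ (TensorProduct.mk ℂ (SuperSym π 𝔮) V 1)).flip

/-- The action of all supermatrices on `S(𝔤/𝔮) ⊗ V`, for an `𝔮`-module `V`, which corresponds to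
the action on the induced module under the Poincaré-Birkhoff-Witt isomorphism. -/
def tensorAct (hd : IsAbelianProjection π 𝔮 d) (M : SuperModule π 𝔮 V) :
    Matrix ι ι ℂ →ₗ[ℂ] Module.End ℂ (SuperSym π 𝔮 ⊗[ℂ] V) :=
  (TensorProduct.lift ((hd.stepHom V).toLinearMap.compl₂ (hd.actBase M))).flip

variable (hd : IsAbelianProjection π 𝔮 d) (M : SuperModule π 𝔮 V) {a b : ZMod 2}
  {X Y : Matrix ι ι ℂ}

lemma tensorAct_tmul (X : Matrix ι ι ℂ) (u : SuperSym π 𝔮) (v : V) :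
    hd.tensorAct M X (u ⊗ₜ v) = hd.stepHom V u (hd.actBase M v) X := rfl

lemma tensorAct_one_tmul (X : Matrix ι ι ℂ) (v : V) :
    hd.tensorAct M X (1 ⊗ₜ v) = gen π 𝔮 X ⊗ₜ v + 1 ⊗ₜ M.act (hd.toSub X) v := by
  rw [tensorAct_tmul, map_one]
  rfl

lemma tensorAct_one_tmul_of_mem (hX : X ∈ 𝔮) (v : V) :
    hd.tensorAct M X (1 ⊗ₜ v) = 1 ⊗ₜ M.act ⟨X, hX⟩ v := by
  rw [tensorAct_one_tmul, gen_eq_zero hX, TensorProduct.zero_tmul, zero_add, hd.toSub_of_mem hX]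

lemma tensorAct_gen_smul (hX : X ∈ homog π a) (hY : Y ∈ homog π b) (t : SuperSym π 𝔮 ⊗[ℂ] V) :
    hd.tensorAct M X (gen π 𝔮 Y • t) =
      hd.tensorAct M (sbracket a b X (d Y)) t + sgn a b • gen π 𝔮 Y • hd.tensorAct M X t := by
  induction t using TensorProduct.induction_on with
  | zero => simp only [smul_zero, map_zero, add_zero]
  | tmul u v =>
    rw [TensorProduct.smul_tmul', smul_eq_mul, tensorAct_tmul, map_mul, Module.End.mul_apply,
      stepHom, SuperSym.lift_gen, actStep_apply hX hY, genAct_apply]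
    rfl
  | add s t hs ht =>
    simp only [smul_add, map_add, hs, ht]
    abel

lemma tensorAct_map (hY : Y ∈ homog π b) (t : SuperSym π 𝔮 ⊗[ℂ] V) :
    hd.tensorAct M (d Y) t = gen π 𝔮 Y • t := by
  suffices h : hd.tensorAct M (d Y) = genAct π 𝔮 V Y from LinearMap.congr_fun h t
  refine SuperSym.tensor_linearMap_eq (fun v => ?_) fun c Z hZ t ht => ?_
  · rw [tensorAct_one_tmul, toSub_map, map_zero, LinearMap.zero_apply, TensorProduct.tmul_zero,
      add_zero, genAct_apply, hd.gen_map, TensorProduct.smul_tmul', smul_eq_mul, mul_one]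
  · rw [tensorAct_gen_smul hd M (hd.homog_mem b Y hY) hZ, ht, hd.sbracket_eq_zero b c Y hY Z hZ,
      map_zero, LinearMap.zero_apply, zero_add, genAct_apply, genAct_apply, ← mul_smul,
      ← mul_smul, gen_mul_gen hY hZ, smul_assoc]

lemma tensorAct_sbracket_map_right (hX : X ∈ homog π a) (hY : Y ∈ homog π b)
    (t : SuperSym π 𝔮 ⊗[ℂ] V) : hd.tensorAct M (sbracket a b X (d Y)) t =
      hd.tensorAct M X (hd.tensorAct M (d Y) t) -
        sgn a b • hd.tensorAct M (d Y) (hd.tensorAct M X t) := by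
  rw [hd.tensorAct_map M hY, hd.tensorAct_map M hY, hd.tensorAct_gen_smul M hX hY,
    add_sub_cancel_right]

lemma tensorAct_sbracket_map_left (hX : X ∈ homog π a) (hY : Y ∈ homog π b)
    (t : SuperSym π 𝔮 ⊗[ℂ] V) : hd.tensorAct M (sbracket a b (d X) Y) t =
      hd.tensorAct M (d X) (hd.tensorAct M Y t) -
        sgn a b • hd.tensorAct M Y (hd.tensorAct M (d X) t) := by
  rw [sbracket_swap, map_neg, map_smul, LinearMap.neg_apply, LinearMap.smul_apply,
    hd.tensorAct_sbracket_map_right M hY hX, smul_sub, smul_smul, sgn_comm b a, sgn_mul_self,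
    one_smul, neg_sub]

lemma tensorAct_sbracket_one_tmul_of_mem (hX : X ∈ 𝔮 ⊓ homog π a) (hY : Y ∈ 𝔮 ⊓ homog π b)
    (v : V) : hd.tensorAct M (sbracket a b X Y) (1 ⊗ₜ v) =
      hd.tensorAct M X (hd.tensorAct M Y (1 ⊗ₜ v)) -
        sgn a b • hd.tensorAct M Y (hd.tensorAct M X (1 ⊗ₜ v)) := by
  simp only [hd.tensorAct_one_tmul_of_mem M hX.1, hd.tensorAct_one_tmul_of_mem M hY.1]
  rw [hd.tensorAct_one_tmul_of_mem M (hd.sbracket_mem a b X hX Y hY),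
    M.act_bracket a b ⟨X, hX.1⟩ ⟨Y, hY.1⟩ _ hX.2 hY.2 rfl, TensorProduct.tmul_sub,
    TensorProduct.tmul_smul]

lemma tensorAct_sbracket_one_tmul (hX : X ∈ homog π a) (hY : Y ∈ homog π b) (v : V) :
    hd.tensorAct M (sbracket a b X Y) (1 ⊗ₜ v) =
      hd.tensorAct M X (hd.tensorAct M Y (1 ⊗ₜ v)) -
        sgn a b • hd.tensorAct M Y (hd.tensorAct M X (1 ⊗ₜ v)) := by
  have hX' : X - d X ∈ 𝔮 ⊓ homog π a :=
    ⟨hd.sub_mem X, Submodule.sub_mem _ hX (hd.homog_mem a X hX)⟩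
  have hY' : Y - d Y ∈ 𝔮 ⊓ homog π b :=
    ⟨hd.sub_mem Y, Submodule.sub_mem _ hY (hd.homog_mem b Y hY)⟩
  have hsplit : sbracket a b X Y = sbracket a b (X - d X) (Y - d Y) +
      sbracket a b (X - d X) (d Y) + sbracket a b (d X) Y := by
    simp only [sbracket, sub_mul, mul_sub]
    module
  rw [hsplit, map_add, map_add, LinearMap.add_apply, LinearMap.add_apply,
    hd.tensorAct_sbracket_one_tmul_of_mem M hX' hY', hd.tensorAct_sbracket_map_right M hX'.2 hY,
    hd.tensorAct_sbracket_map_left M hX hY]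
  simp only [map_sub, LinearMap.sub_apply]
  module

lemma tensorAct_sbracket (hX : X ∈ homog π a) (hY : Y ∈ homog π b) (t : SuperSym π 𝔮 ⊗[ℂ] V) :
    hd.tensorAct M (sbracket a b X Y) t =
      hd.tensorAct M X (hd.tensorAct M Y t) - sgn a b • hd.tensorAct M Y (hd.tensorAct M X t) := by
  induction t using SuperSym.tensor_induction generalizing a b X Y with
  | one_tmul v => exact hd.tensorAct_sbracket_one_tmul M hX hY v
  | add s t hs ht =>
    simp only [map_add, hs hX hY, ht hX hY]
    module
  | smul c t ht =>
    simp only [map_smul, ht hX hY]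
    module
  | gen_smul c Z hZ t ht =>
    have hdZ := hd.homog_mem c Z hZ
    rw [hd.tensorAct_gen_smul M (SuperPair.sbracket_mem hX hY) hZ, hd.tensorAct_gen_smul M hX hZ,
      hd.tensorAct_gen_smul M hY hZ, sbracket_jacobi, map_add, map_smul, LinearMap.add_apply,
      LinearMap.smul_apply, ht hX (SuperPair.sbracket_mem hY hdZ),
      ht (SuperPair.sbracket_mem hX hdZ) hY, ht hX hY]
    simp only [map_add, map_smul, hd.tensorAct_gen_smul M hX hZ, hd.tensorAct_gen_smul M hY hZ,
      sgn_add, sgn_add_right, sgn_comm c b]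
    simp only [← genAct_apply, map_sub, map_smul]
    rcases mul_self_eq_one_iff.1 (sgn_mul_self b c) with h | h <;> simp only [h] <;> module

end IsAbelianProjection

lemma U.induction {ι : Type} [Fintype ι] {π : ι → ZMod 2} {motive : U π → Prop} (u : U π)
    (algebraMap : ∀ r, motive (algebraMap ℂ (U π) r)) (of : ∀ X, motive (U.of π X))
    (mul : ∀ a b, motive a → motive b → motive (a * b))
    (add : ∀ a b, motive a → motive b → motive (a + b)) : motive u := by
  obtain ⟨u, rfl⟩ : ∃ x, U.mk π x = u := RingQuot.mkAlgHom_surjective ℂ (Rel π) u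
  induction u using TensorAlgebra.induction with
  | algebraMap r => rw [AlgHom.commutes]; exact algebraMap r
  | ι X => exact of X
  | mul x y hx hy => rw [map_mul]; exact mul _ _ hx hy
  | add x y hx hy => rw [map_add]; exact add _ _ hx hy

namespace IsAbelianProjection

variable {ι : Type} [Fintype ι] {π : ι → ZMod 2} {𝔮 : Submodule ℂ (Matrix ι ι ℂ)}
  {d : Matrix ι ι ℂ →ₗ[ℂ] Matrix ι ι ℂ} {V : Type} [AddCommGroup V] [Module ℂ V]
  (hd : IsAbelianProjection π 𝔮 d) (M : SuperModule π 𝔮 V)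

/-- The extension of `tensorAct` to the enveloping superalgebra. -/
def tensorActU : U π →ₐ[ℂ] Module.End ℂ (SuperSym π 𝔮 ⊗[ℂ] V) :=
  RingQuot.liftAlgHom ℂ ⟨TensorAlgebra.lift ℂ (hd.tensorAct M), by
    rintro _ _ ⟨a, b, X, Y, hX, hY⟩
    simp only [map_sub (TensorAlgebra.lift ℂ _), map_smul, map_mul, TensorAlgebra.lift_ι_apply]
    exact LinearMap.ext fun t => (hd.tensorAct_sbracket M hX hY t).symm⟩

lemma tensorActU_of (X : Matrix ι ι ℂ) : hd.tensorActU M (U.of π X) = hd.tensorAct M X :=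
  (RingQuot.liftAlgHom_mkAlgHom_apply ℂ _ _ _).trans (TensorAlgebra.lift_ι_apply _ X)

/-- The map `u ⊗ v ↦ u (1 ⊗ v)` underlying `toTensor`. -/
def toTensorAux : U π ⊗[ℂ] V →ₗ[ℂ] SuperSym π 𝔮 ⊗[ℂ] V :=
  TensorProduct.lift
    ((hd.tensorActU M).toLinearMap.compl₂ (TensorProduct.mk ℂ (SuperSym π 𝔮) V 1))

lemma toTensorAux_tmul (u : U π) (v : V) :
    hd.toTensorAux M (u ⊗ₜ v) = hd.tensorActU M u (1 ⊗ₜ v) := rfl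

lemma toTensorAux_smul (u : U π) (z : U π ⊗[ℂ] V) :
    hd.toTensorAux M (u • z) = hd.tensorActU M u (hd.toTensorAux M z) := by
  induction z using TensorProduct.induction_on with
  | zero => rw [smul_zero, map_zero, map_zero]
  | tmul x v =>
    rw [TensorProduct.smul_tmul', smul_eq_mul, toTensorAux_tmul, map_mul, Module.End.mul_apply,
      toTensorAux_tmul]
  | add x y hx hy => rw [smul_add, map_add, hx, hy, map_add, map_add]

lemma balanced_le_ker_toTensorAux :
    M.balanced.restrictScalars ℂ ≤ LinearMap.ker (hd.toTensorAux M) := by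
  intro z hz
  change hd.toTensorAux M z = 0
  induction hz using Submodule.span_induction with
  | mem z hz =>
    obtain ⟨u, X, v, rfl⟩ := hz
    rw [map_sub, toTensorAux_tmul, toTensorAux_tmul, map_mul, tensorActU_of,
      Module.End.mul_apply, hd.tensorAct_one_tmul_of_mem M X.2, sub_self]
  | zero => exact map_zero _
  | add x y _ _ hx hy => rw [map_add, hx, hy, add_zero]
  | smul u z _ hz => rw [toTensorAux_smul, hz, map_zero]

/-- The map `u ⊗ v ↦ u (1 ⊗ v)` from the induced module to `S(𝔤/𝔮) ⊗ V`. -/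
def toTensor : M.IndSpace →ₗ[ℂ] SuperSym π 𝔮 ⊗[ℂ] V :=
  (M.balanced.restrictScalars ℂ).liftQ (hd.toTensorAux M) (hd.balanced_le_ker_toTensorAux M) ∘ₗ
    (Submodule.Quotient.restrictScalarsEquiv ℂ M.balanced).symm.toLinearMap

lemma toTensor_mk (z : U π ⊗[ℂ] V) :
    hd.toTensor M (Submodule.Quotient.mk z) = hd.toTensorAux M z := rfl

lemma toTensor_of_smul (X : Matrix ι ι ℂ) (z : M.IndSpace) :
    hd.toTensor M (U.of π X • z) = hd.tensorAct M X (hd.toTensor M z) := by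
  induction z using Submodule.Quotient.induction_on with
  | H z =>
    rw [← Submodule.Quotient.mk_smul, toTensor_mk, toTensor_mk, toTensorAux_smul, tensorActU_of]

/-- The homomorphism from the supersymmetric algebra to the enveloping superalgebra which
identifies it with the enveloping superalgebra of the range of `d`. -/
def symToU : SuperSym π 𝔮 →ₐ[ℂ] U π :=
  SuperSym.lift (U.of π ∘ₗ d)
    (fun a b X hX Y hY => sub_eq_zero.1 <|
      (U.of_bracket (hd.homog_mem a X hX) (hd.homog_mem b Y hY)).trans <|
        (congrArg (U.of π) (hd.sbracket_eq_zero a b X hX Y hY)).trans (map_zero _))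
    (fun X hX => by rw [LinearMap.comp_apply, hd.eq_zero X hX, map_zero])

lemma symToU_gen (X : Matrix ι ι ℂ) : hd.symToU (SuperSym.gen π 𝔮 X) = U.of π (d X) :=
  SuperSym.lift_gen _ _ _ _

/-- The map `x ⊗ v ↦ x ⊗ v` from `S(𝔤/𝔮) ⊗ V` to the induced module, a left inverse of
`toTensor`. -/
def ofTensor : SuperSym π 𝔮 ⊗[ℂ] V →ₗ[ℂ] M.IndSpace :=
  M.balanced.mkQ.restrictScalars ℂ ∘ₗ TensorProduct.map hd.symToU.toLinearMap LinearMap.id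

lemma ofTensor_tmul (x : SuperSym π 𝔮) (v : V) :
    hd.ofTensor M (x ⊗ₜ v) = Submodule.Quotient.mk (hd.symToU x ⊗ₜ v) := rfl

lemma ofTensor_gen_smul (X : Matrix ι ι ℂ) (t : SuperSym π 𝔮 ⊗[ℂ] V) :
    hd.ofTensor M (SuperSym.gen π 𝔮 X • t) = U.of π (d X) • hd.ofTensor M t := by
  induction t using TensorProduct.induction_on with
  | zero => rw [smul_zero, map_zero, smul_zero]
  | tmul x v =>
    rw [TensorProduct.smul_tmul', smul_eq_mul, ofTensor_tmul, map_mul, symToU_gen,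
      ofTensor_tmul, ← Submodule.Quotient.mk_smul, TensorProduct.smul_tmul', smul_eq_mul]
  | add x y hx hy => rw [smul_add, map_add, hx, hy, map_add, smul_add]

lemma ofTensor_tensorAct_one_tmul (X : Matrix ι ι ℂ) (v : V) :
    hd.ofTensor M (hd.tensorAct M X (1 ⊗ₜ v)) = U.of π X • hd.ofTensor M (1 ⊗ₜ v) := by
  have move_across : (Submodule.Quotient.mk ((1 * U.of π (hd.toSub X : Matrix ι ι ℂ)) ⊗ₜ[ℂ] v) :
      M.IndSpace) = Submodule.Quotient.mk (1 ⊗ₜ[ℂ] M.act (hd.toSub X) v) :=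
    (Submodule.Quotient.eq _).2 (Submodule.subset_span ⟨1, hd.toSub X, v, rfl⟩)
  rw [one_mul] at move_across
  rw [tensorAct_one_tmul, map_add, ofTensor_tmul, ofTensor_tmul, ofTensor_tmul, symToU_gen,
    map_one, ← move_across, ← Submodule.Quotient.mk_add, ← TensorProduct.add_tmul, ← map_add,
    coe_toSub, add_sub_cancel, ← Submodule.Quotient.mk_smul, TensorProduct.smul_tmul',
    smul_eq_mul, mul_one]

lemma ofTensor_tensorAct_of_mem {a : ZMod 2} {X : Matrix ι ι ℂ} (hX : X ∈ homog π a)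
    (t : SuperSym π 𝔮 ⊗[ℂ] V) :
    hd.ofTensor M (hd.tensorAct M X t) = U.of π X • hd.ofTensor M t := by
  induction t using SuperSym.tensor_induction generalizing a X with
  | one_tmul v => exact hd.ofTensor_tensorAct_one_tmul M X v
  | add s t hs ht => rw [map_add, map_add, hs hX, ht hX, map_add, smul_add]
  | smul c t ht => rw [map_smul, map_smul, ht hX, map_smul, smul_comm]
  | gen_smul b Y hY t ht =>
    have hdY := hd.homog_mem b Y hY
    rw [hd.tensorAct_gen_smul M hX hY, map_add, map_smul, ofTensor_gen_smul, ofTensor_gen_smul,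
      ht (SuperPair.sbracket_mem hX hdY), ht hX, sbracket, ← U.of_bracket hX hdY, sub_smul,
      smul_assoc, mul_smul, mul_smul, sub_add_cancel]

lemma ofTensor_tensorAct (X : Matrix ι ι ℂ) (t : SuperSym π 𝔮 ⊗[ℂ] V) :
    hd.ofTensor M (hd.tensorAct M X t) = U.of π X • hd.ofTensor M t := by
  rw [← part_add_part π X, map_add, LinearMap.add_apply, map_add,
    hd.ofTensor_tensorAct_of_mem M (part_mem π 0 X),
    hd.ofTensor_tensorAct_of_mem M (part_mem π 1 X), map_add, add_smul]

lemma ofTensor_tensorActU (u : U π) (t : SuperSym π 𝔮 ⊗[ℂ] V) :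
    hd.ofTensor M (hd.tensorActU M u t) = u • hd.ofTensor M t := by
  induction u using U.induction generalizing t with
  | algebraMap r => rw [AlgHom.commutes, Module.algebraMap_end_apply, map_smul, algebraMap_smul]
  | of X => rw [tensorActU_of, ofTensor_tensorAct]
  | mul x y hx hy => rw [map_mul, Module.End.mul_apply, hx, hy, mul_smul]
  | add x y hx hy => rw [map_add, LinearMap.add_apply, map_add, hx, hy, add_smul]

lemma ofTensor_toTensor (z : M.IndSpace) : hd.ofTensor M (hd.toTensor M z) = z := by
  induction z using Submodule.Quotient.induction_on with
  | H z =>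
    rw [toTensor_mk]
    induction z using TensorProduct.induction_on with
    | zero => rw [map_zero, map_zero, Submodule.Quotient.mk_zero]
    | tmul u v =>
      rw [toTensorAux_tmul, ofTensor_tensorActU, ofTensor_tmul, map_one,
        ← Submodule.Quotient.mk_smul, TensorProduct.smul_tmul', smul_eq_mul, mul_one]
    | add x y hx hy => rw [map_add, map_add, hx, hy, Submodule.Quotient.mk_add]

lemma toTensor_injective : Function.Injective (hd.toTensor M) :=
  Function.LeftInverse.injective (hd.ofTensor_toTensor M)

end IsAbelianProjection

/-! ### Singular vectors -/

section MatrixUnits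

variable {ι : Type} [DecidableEq ι]

lemma diagonal_mem_homog (π : ι → ZMod 2) (c : ι → ℂ) : Matrix.diagonal c ∈ homog π 0 := by
  intro i j h
  exact Matrix.diagonal_apply_ne _ fun hij => h (hij ▸ CharTwo.add_self_eq_zero _)

lemma single_one_mem_homog (π : ι → ZMod 2) (i j : ι) :
    Matrix.single i j (1 : ℂ) ∈ homog π (π i + π j) := by
  intro k l h
  refine Matrix.single_apply_of_ne _ _ _ _ _ ?_
  rintro ⟨rfl, rfl⟩
  exact h rfl

lemma linearMap_apply_mem_of_single [Finite ι] {V : Type*} [AddCommGroup V] [Module ℂ V]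
    {f : Matrix ι ι ℂ →ₗ[ℂ] V} {P : Submodule ℂ V} (h : ∀ i j, f (Matrix.single i j 1) ∈ P)
    (X : Matrix ι ι ℂ) : f X ∈ P := by
  induction X using Matrix.induction_on' with
  | h_zero => rw [map_zero]; exact P.zero_mem
  | h_add X Y hX hY => rw [map_add]; exact P.add_mem hX hY
  | h_std_basis i j x =>
    rw [← mul_one x, ← smul_eq_mul, ← Matrix.smul_single, map_smul]
    exact P.smul_mem x (h i j)

lemma diagonal_mul_single_sub [Fintype ι] (c : ι → ℂ) (i j : ι) :
    Matrix.diagonal c * Matrix.single i j 1 - Matrix.single i j 1 * Matrix.diagonal c =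
      (c i - c j) • Matrix.single i j (1 : ℂ) := by
  ext k l
  rw [Matrix.sub_apply, Matrix.diagonal_mul, Matrix.mul_diagonal, Matrix.smul_apply,
    Matrix.single_apply, smul_eq_mul]
  split_ifs with h
  · rw [← h.1, ← h.2]; ring
  · ring

end MatrixUnits

section Action

variable {ι : Type} [Fintype ι] (π : ι → ZMod 2) (V : Type*) [AddCommGroup V] [Module ℂ V]
  [Module (U π) V] [IsScalarTower ℂ (U π) V]

/-- The action of supermatrices on a module over the enveloping superalgebra. -/
def uAct : Matrix ι ι ℂ →ₗ[ℂ] Module.End ℂ V :=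
  (Algebra.lsmul ℂ ℂ V).toLinearMap ∘ₗ U.of π

variable {V}

lemma uAct_apply (X : Matrix ι ι ℂ) (v : V) : uAct π V X v = U.of π X • v := rfl

variable {π}

lemma uAct_uAct {a b : ZMod 2} {X Y : Matrix ι ι ℂ} (hX : X ∈ homog π a) (hY : Y ∈ homog π b)
    (v : V) : uAct π V X (uAct π V Y v) =
      uAct π V (sbracket a b X Y) v + sgn a b • uAct π V Y (uAct π V X v) := by
  simp only [uAct_apply, sbracket, ← U.of_bracket hX hY, sub_smul, smul_assoc, mul_smul,
    sub_add_cancel]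

lemma U.smul_mem_of_le_comap {P : Submodule ℂ V} (hP : ∀ X, P ≤ P.comap (uAct π V X)) (u : U π)
    {v : V} (hv : v ∈ P) : u • v ∈ P := by
  induction u using U.induction generalizing v with
  | algebraMap r => rw [algebraMap_smul]; exact P.smul_mem r hv
  | of X => exact hP X hv
  | mul x y hx hy => rw [mul_smul]; exact hx (hy hv)
  | add x y hx hy => rw [add_smul]; exact P.add_mem (hx hv) (hy hv)

variable (π V) [DecidableEq ι]

lemma lie_uAct_diagonal_uAct_single (c : ι → ℂ) (i j : ι) :
    ⁅uAct π V (Matrix.diagonal c), uAct π V (Matrix.single i j 1)⁆ =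
      (c i - c j) • uAct π V (Matrix.single i j 1) := by
  ext1 v
  rw [Ring.lie_def, LinearMap.sub_apply, Module.End.mul_apply, Module.End.mul_apply,
    uAct_uAct (diagonal_mem_homog π c) (single_one_mem_homog π i j), sbracket, sgn_zero_left,
    one_smul, one_smul, diagonal_mul_single_sub, map_smul, add_sub_cancel_right]

end Action

section Singular

variable {ι : Type} [Fintype ι] [DecidableEq ι] (h : ι → ℕ) (π : ι → ZMod 2) {V : Type*}
  [AddCommGroup V] [Module ℂ V] [Module (U π) V] [IsScalarTower ℂ (U π) V]

/-- The smallest subspace which contains `K` and is stable under the lowering operators `E_ij` with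
`h j < h i`; it plays the role of `U(𝔫⁻) K`. -/
def loweringClosure (K : Submodule ℂ V) : Submodule ℂ V :=
  sInf {P | K ≤ P ∧ ∀ i j, h j < h i → P ≤ P.comap (uAct π V (Matrix.single i j 1))}

variable {h π} {K P : Submodule ℂ V}

lemma le_loweringClosure : K ≤ loweringClosure h π K := le_sInf fun _ hP => hP.1

lemma loweringClosure_le (hKP : K ≤ P)
    (hP : ∀ i j, h j < h i → P ≤ P.comap (uAct π V (Matrix.single i j 1))) :
    loweringClosure h π K ≤ P :=
  sInf_le ⟨hKP, hP⟩

lemma loweringClosure_le_comap {i j : ι} (hij : h j < h i) : loweringClosure h π K ≤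
    (loweringClosure h π K).comap (uAct π V (Matrix.single i j 1)) :=
  fun _ hv => Submodule.mem_sInf.2 fun P hP => hP.2 i j hij (Submodule.mem_sInf.1 hv P hP)

lemma loweringClosure_le_comap_uAct
    (hK : ∀ i j, h i ≤ h j → K ≤ K.comap (uAct π V (Matrix.single i j 1))) (X : Matrix ι ι ℂ) :
    loweringClosure h π K ≤ (loweringClosure h π K).comap (uAct π V X) := by
  set C := loweringClosure h π K
  suffices hC : C ≤ C ⊓ ⨅ X, C.comap (uAct π V X) from
    fun v hv => (Submodule.mem_iInf _).1 (hC hv).2 X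
  have mem_comap {v : V} (hv : ∀ i j, uAct π V (Matrix.single i j 1) v ∈ C) :
      v ∈ ⨅ X, C.comap (uAct π V X) :=
    (Submodule.mem_iInf _).2 (linearMap_apply_mem_of_single (f := (uAct π V).flip v) hv)
  refine loweringClosure_le (le_inf le_loweringClosure fun v hv => mem_comap fun i j => ?_)
    fun i j hij v hv => ⟨loweringClosure_le_comap hij hv.1, mem_comap fun k l => ?_⟩
  · rcases lt_or_ge (h j) (h i) with hij | hij
    · exact loweringClosure_le_comap hij (le_loweringClosure hv)
    · exact le_loweringClosure (hK i j hij hv)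
  · have hv' := (Submodule.mem_iInf _).1 hv.2
    rw [uAct_uAct (single_one_mem_homog π k l) (single_one_mem_homog π i j)]
    exact C.add_mem (hv' _) (C.smul_mem _ (loweringClosure_le_comap hij (hv' _)))

lemma smul_mem_of_lowering_stable (hKP : K ≤ P)
    (hK : ∀ i j, h i ≤ h j → K ≤ K.comap (uAct π V (Matrix.single i j 1)))
    (hP : ∀ i j, h j < h i → P ≤ P.comap (uAct π V (Matrix.single i j 1))) (u : U π) {v : V}
    (hv : v ∈ K) : u • v ∈ P :=
  loweringClosure_le hKP hP <|
    U.smul_mem_of_le_comap (loweringClosure_le_comap_uAct hK) u (le_loweringClosure hv)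

variable (h π V) in
/-- The vectors killed by the raising operators `E_ij` with `h i < h j`. -/
def singularVectors : Submodule ℂ V :=
  ⨅ ij : {ij : ι × ι // h ij.1 < h ij.2},
    LinearMap.ker (uAct π V (Matrix.single ij.1.1 ij.1.2 1))

lemma mem_singularVectors {v : V} : v ∈ singularVectors h π V ↔
    ∀ i j, h i < h j → uAct π V (Matrix.single i j 1) v = 0 := by
  simp only [singularVectors, Submodule.mem_iInf, LinearMap.mem_ker, Subtype.forall, Prod.forall]

lemma singularVectors_le_comap_single_self (k : ι) : singularVectors h π V ≤
    (singularVectors h π V).comap (uAct π V (Matrix.single k k 1)) := fun v hv =>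
  mem_singularVectors.2 fun i j hij => by
    have hv := mem_singularVectors.1 hv i j hij
    have hlie := LinearMap.congr_fun (lie_uAct_diagonal_uAct_single π V (Pi.single k 1) i j) v
    rwa [Matrix.diagonal_single, Ring.lie_def, LinearMap.sub_apply, Module.End.mul_apply,
      Module.End.mul_apply, LinearMap.smul_apply, hv, map_zero, smul_zero, zero_sub,
      neg_eq_zero] at hlie

variable (h) in
/-- The diagonal supermatrix with entries `h i`, with respect to which `E_ij` has degree
`h i - h j`. -/
def heightMatrix : Matrix ι ι ℂ := Matrix.diagonal fun i => (h i : ℂ)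

lemma eigenspaceFrom_heightMatrix_le_comap {i j : ι} (hij : h j < h i) (y : ℂ) :
    eigenspaceFrom (uAct π V (heightMatrix h)) y ≤
      (eigenspaceFrom (uAct π V (heightMatrix h)) (y + 1)).comap
        (uAct π V (Matrix.single i j 1)) := by
  obtain ⟨m, hm⟩ := Nat.exists_eq_add_of_lt hij
  refine (eigenspaceFrom_le_comap_of_lie_eq_smul (k := 1 + m) ?_ y).trans
    (Submodule.comap_mono ?_)
  · rw [heightMatrix, lie_uAct_diagonal_uAct_single, hm]
    push_cast
    congr 1
    ring
  · rw [Nat.cast_add, Nat.cast_one, ← add_assoc]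
    exact eigenspaceFrom_add_natCast_le _ _ m

lemma eigenspaceFrom_heightMatrix_lowering_stable (y : ℂ) (i j : ι) (hij : h j < h i) :
    eigenspaceFrom (uAct π V (heightMatrix h)) y ≤
      (eigenspaceFrom (uAct π V (heightMatrix h)) y).comap (uAct π V (Matrix.single i j 1)) :=
  (eigenspaceFrom_heightMatrix_le_comap hij y).trans <| Submodule.comap_mono <| by
    simpa only [Nat.cast_one] using eigenspaceFrom_add_natCast_le _ y 1

lemma smul_mem_eigenspaceFrom_of_mem_singularVectors (hh : Function.Injective h) {y : ℂ} {v : V}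
    (hv : v ∈ singularVectors h π V) (hvy : v ∈ eigenspaceFrom (uAct π V (heightMatrix h)) y)
    (u : U π) : u • v ∈ eigenspaceFrom (uAct π V (heightMatrix h)) y := by
  refine smul_mem_of_lowering_stable (K := singularVectors h π V ⊓ eigenspaceFrom _ y)
    inf_le_right (fun i j hij w hw => ?_) (eigenspaceFrom_heightMatrix_lowering_stable y) u
    ⟨hv, hvy⟩
  rcases hij.lt_or_eq with hij | hij
  · rw [Submodule.mem_comap, mem_singularVectors.1 hw.1 i j hij]
    exact Submodule.zero_mem _
  · obtain rfl := hh hij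
    refine ⟨singularVectors_le_comap_single_self i hw.1,
      eigenspaceFrom_le_comap_of_lie_eq_zero ?_ y hw.2⟩
    rw [heightMatrix, lie_uAct_diagonal_uAct_single, sub_self, zero_smul]

end Singular

section HighestWeightVector

variable {p q : ℕ}

/-- The position of a basis index in the order `ε₁ … ε_p δ₁ … δ_q`. -/
def ht : Fin p ⊕ Fin q → ℕ := Sum.elim (fun i => i) (fun j => p + j)

lemma lex_iff_ht_lt (i j : Fin p ⊕ Fin q) : Sum.Lex (· < ·) (· < ·) i j ↔ ht i < ht j := by
  rcases i with i | i <;> rcases j with j | j <;>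
    simp only [ht, Sum.lex_inl_inl, Sum.Lex.sep, Sum.lex_inr_inl, Sum.lex_inr_inr, Sum.elim_inl,
      Sum.elim_inr, Fin.lt_def, true_iff, false_iff] <;> omega

lemma ht_injective : Function.Injective (ht (p := p) (q := q)) := by
  rintro (i | i) (j | j) h <;>
    simp only [ht, Sum.elim_inl, Sum.elim_inr, Sum.inl.injEq, Sum.inr.injEq, Fin.ext_iff,
      reduceCtorEq] at h ⊢ <;> omega

variable (κ : Fin p ⊕ Fin q → ℂ)

/-- The highest weight vector of `L(κ)`. -/
def hwVec : LSpace κ := Submodule.Quotient.mk (Submodule.Quotient.mk 1)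

lemma mk_mk_eq_smul_hwVec (u : U (parity p q)) :
    (Submodule.Quotient.mk (Submodule.Quotient.mk u) : LSpace κ) = u • hwVec κ := by
  rw [hwVec, ← Submodule.Quotient.mk_smul, ← Submodule.Quotient.mk_smul, smul_eq_mul, mul_one]

lemma exists_eq_smul_hwVec (v : LSpace κ) : ∃ u : U (parity p q), v = u • hwVec κ := by
  obtain ⟨v, rfl⟩ := Submodule.Quotient.mk_surjective _ v
  obtain ⟨u, rfl⟩ := Submodule.Quotient.mk_surjective _ v
  exact ⟨u, mk_mk_eq_smul_hwVec κ u⟩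

lemma hwVec_mem_singularVectors : hwVec κ ∈ singularVectors ht (parity p q) (LSpace κ) :=
  mem_singularVectors.2 fun i j hij => by
    have hmem : U.of (parity p q) (Matrix.single i j 1) ∈ vermaIdeal κ :=
      Submodule.subset_span (Or.inl ⟨i, j, (lex_iff_ht_lt i j).2 hij, rfl⟩)
    rw [uAct_apply, ← mk_mk_eq_smul_hwVec, (Submodule.Quotient.mk_eq_zero _).2 hmem,
      Submodule.Quotient.mk_zero]

lemma uAct_single_self_hwVec (i : Fin p ⊕ Fin q) :
    uAct (parity p q) (LSpace κ) (Matrix.single i i 1) (hwVec κ) = κ i • hwVec κ := by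
  rw [uAct_apply, ← algebraMap_smul (U (parity p q)) (κ i), ← mk_mk_eq_smul_hwVec,
    ← mk_mk_eq_smul_hwVec]
  exact congrArg _ ((Submodule.Quotient.eq _).2 (Submodule.subset_span (Or.inr ⟨i, rfl⟩)))

lemma uAct_diagonal_hwVec (c : Fin p ⊕ Fin q → ℂ) :
    uAct (parity p q) (LSpace κ) (Matrix.diagonal c) (hwVec κ) = (∑ i, c i * κ i) • hwVec κ := by
  have single_eq (i : Fin p ⊕ Fin q) :
      Matrix.single i i (c i) = c i • Matrix.single i i (1 : ℂ) := by
    rw [Matrix.smul_single, smul_eq_mul, mul_one]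
  simp only [← Matrix.sum_single_eq_diagonal, single_eq, map_sum, map_smul, LinearMap.sum_apply,
    LinearMap.smul_apply, uAct_single_self_hwVec, Finset.sum_smul, smul_smul]

lemma exists_smul_eq_of_ne_zero {v : LSpace κ} (hv : v ≠ 0) (w : LSpace κ) :
    ∃ u : U (parity p q), u • v = w := by
  suffices hspan : Submodule.span (U (parity p q)) {v} = ⊤ from
    Submodule.mem_span_singleton.1 (hspan ▸ Submodule.mem_top)
  by_contra hspan
  refine hv ?_
  obtain ⟨v, rfl⟩ := Submodule.mkQ_surjective _ v
  have hproper : (Submodule.span (U (parity p q)) {(vermaRadical κ).mkQ v}).comap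
      (vermaRadical κ).mkQ ≠ ⊤ := fun htop => hspan <| by
    rw [← Submodule.map_comap_eq_of_surjective (vermaRadical κ).mkQ_surjective (Submodule.span _ _),
      htop, Submodule.map_top, Submodule.range_mkQ]
  exact (Submodule.Quotient.mk_eq_zero _).2 <|
    (le_sSup hproper : _ ≤ vermaRadical κ) (Submodule.mem_span_singleton_self _)

lemma span_hwVec_sup_eigenspaceFrom_eq_top (y : ℂ) (hy : uAct (parity p q) (LSpace κ)
      (heightMatrix ht) (hwVec κ) = y • hwVec κ) : Submodule.span ℂ {hwVec κ} ⊔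
      eigenspaceFrom (uAct (parity p q) (LSpace κ) (heightMatrix ht)) (y + 1) = ⊤ := by
  refine eq_top_iff.2 fun v _ => ?_
  obtain ⟨u, rfl⟩ := exists_eq_smul_hwVec κ v
  refine smul_mem_of_lowering_stable (h := ht) le_sup_left (fun i j hij => ?_) (fun i j hij => ?_)
    u (Submodule.mem_span_singleton_self _)
  · rw [Submodule.span_singleton_le_iff_mem, Submodule.mem_comap]
    rcases hij.lt_or_eq with hij | hij
    · rw [mem_singularVectors.1 (hwVec_mem_singularVectors κ) i j hij]
      exact Submodule.zero_mem _
    · rw [ht_injective hij, uAct_single_self_hwVec]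
      exact Submodule.smul_mem _ _ (Submodule.mem_span_singleton_self _)
  · have hspan : Submodule.span ℂ {hwVec κ} ≤ eigenspaceFrom _ y :=
      (Submodule.span_singleton_le_iff_mem _ _).2 (mem_eigenspaceFrom 0 (by simpa using hy))
    refine (sup_le hspan ?_).trans <| (eigenspaceFrom_heightMatrix_le_comap hij y).trans <|
      Submodule.comap_mono le_sup_right
    simpa only [Nat.cast_one] using eigenspaceFrom_add_natCast_le _ y 1

lemma singularVectors_LSpace_le :
    singularVectors ht (parity p q) (LSpace κ) ≤ Submodule.span ℂ {hwVec κ} := fun v hv => by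
  set H := uAct (parity p q) (LSpace κ) (heightMatrix ht)
  obtain ⟨y, hy⟩ : ∃ y, H (hwVec κ) = y • hwVec κ := ⟨_, uAct_diagonal_hwVec κ _⟩
  obtain ⟨w, hw, l, hl, rfl⟩ := Submodule.mem_sup.1 <|
    (span_hwVec_sup_eigenspaceFrom_eq_top κ y hy).ge (Submodule.mem_top (x := v))
  have hw_singular : w ∈ singularVectors ht (parity p q) (LSpace κ) :=
    (Submodule.span_singleton_le_iff_mem _ _).2 (hwVec_mem_singularVectors κ) hw
  have hl_singular := (Submodule.add_mem_iff_right _ hw_singular).1 hv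
  suffices hl₀ : l = 0 by rwa [hl₀, add_zero]
  by_contra hl₀
  obtain ⟨u, hu⟩ := exists_smul_eq_of_ne_zero κ hl₀ (hwVec κ)
  have hhw : hwVec κ = 0 := eq_zero_of_mem_eigenspaceFrom_add_one hy <| hu ▸
    smul_mem_eigenspaceFrom_of_mem_singularVectors ht_injective hl_singular hl u
  obtain ⟨u', rfl⟩ := exists_eq_smul_hwVec κ l
  exact hl₀ (by rw [hhw, smul_zero])

end HighestWeightVector

/-! ### The part of the action coming from the supersymmetric algebra -/

namespace SuperSym

variable {ι : Type} {π : ι → ZMod 2} {𝔮 : Submodule ℂ (Matrix ι ι ℂ)}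
  {V : Type*} [AddCommGroup V] [Module ℂ V] (h𝔮 : IsGraded π 𝔮) (a : ZMod 2)
  (φ : Module.End ℂ V)

lemma lTensor_gen_smul (Y : Matrix ι ι ℂ) (t : SuperSym π 𝔮 ⊗[ℂ] V) :
    φ.lTensor _ (gen π 𝔮 Y • t) = gen π 𝔮 Y • φ.lTensor _ t := by
  induction t using TensorProduct.induction_on with
  | zero => simp only [smul_zero, map_zero]
  | tmul x v => rfl
  | add s t hs ht => rw [smul_add, map_add, hs, ht, map_add, smul_add]

variable [Fintype ι]

/-- The algebra endomorphism `x ↦ (-1)^(|x| a) x` of the supersymmetric algebra. -/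
def signHom (h𝔮 : IsGraded π 𝔮) (a : ZMod 2) : SuperSym π 𝔮 →ₐ[ℂ] SuperSym π 𝔮 :=
  lift (gen π 𝔮 ∘ₗ twist π a)
    (fun b c X hX Y hY => by
      simp only [LinearMap.comp_apply, twist_of_mem hX, twist_of_mem hY, map_smul,
        smul_mul_smul_comm, gen_mul_gen hX hY]
      module)
    (fun X hX => gen_eq_zero <|
      Submodule.add_mem _ (h𝔮 X hX 0) (Submodule.smul_mem _ _ (h𝔮 X hX 1)))

/-- The operator `1 ⊗ φ` on `S(𝔤/𝔮) ⊗ V` for an operator `φ` of parity `a`, including the sign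
which arises when `φ` moves past the first factor. -/
def superLTensor (h𝔮 : IsGraded π 𝔮) (a : ZMod 2) (φ : Module.End ℂ V) :
    Module.End ℂ (SuperSym π 𝔮 ⊗[ℂ] V) :=
  TensorProduct.map (signHom h𝔮 a).toLinearMap φ

lemma superLTensor_one_tmul (v : V) : superLTensor h𝔮 a φ (1 ⊗ₜ v) = 1 ⊗ₜ φ v := by
  rw [superLTensor, TensorProduct.map_tmul, AlgHom.toLinearMap_apply, map_one]

lemma superLTensor_gen_smul {b : ZMod 2} {Y : Matrix ι ι ℂ} (hY : Y ∈ homog π b)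
    (t : SuperSym π 𝔮 ⊗[ℂ] V) :
    superLTensor h𝔮 a φ (gen π 𝔮 Y • t) = sgn b a • gen π 𝔮 Y • superLTensor h𝔮 a φ t := by
  induction t using TensorProduct.induction_on with
  | zero => simp only [smul_zero, map_zero]
  | tmul x v =>
    have signHom_mul : signHom h𝔮 a (gen π 𝔮 Y * x) =
        sgn b a • (gen π 𝔮 Y * signHom h𝔮 a x) := by
      rw [map_mul, signHom, lift_gen, LinearMap.comp_apply, twist_of_mem hY, map_smul,
        smul_mul_assoc]
    rw [TensorProduct.smul_tmul', smul_eq_mul, superLTensor, TensorProduct.map_tmul,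
      AlgHom.toLinearMap_apply, signHom_mul]
    rfl
  | add s t hs ht => rw [smul_add, map_add, hs, ht, map_add, smul_add, smul_add]

lemma superLTensor_zero : superLTensor h𝔮 0 φ = φ.lTensor _ :=
  tensor_linearMap_eq (superLTensor_one_tmul h𝔮 0 φ) fun b Y hY t ht => by
    rw [superLTensor_gen_smul h𝔮 0 φ hY, ht, sgn_comm, sgn_zero_left, one_smul, lTensor_gen_smul]

lemma superLTensor_comp_superLTensor (φ ψ : Module.End ℂ V) :
    superLTensor h𝔮 a φ ∘ₗ superLTensor h𝔮 a ψ = (φ ∘ₗ ψ).lTensor _ :=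
  tensor_linearMap_eq
    (fun v => by
      rw [LinearMap.comp_apply, superLTensor_one_tmul, superLTensor_one_tmul,
        LinearMap.lTensor_tmul, LinearMap.comp_apply])
    fun b Y hY t ht => by
      rw [LinearMap.comp_apply, superLTensor_gen_smul h𝔮 a ψ hY, map_smul,
        superLTensor_gen_smul h𝔮 a φ hY, smul_smul, sgn_mul_self, one_smul, ← LinearMap.comp_apply,
        ht, lTensor_gen_smul]

lemma lTensor_eq_zero_of_superLTensor_eq_zero {t : SuperSym π 𝔮 ⊗[ℂ] V}
    (ht : superLTensor h𝔮 a φ t = 0) : φ.lTensor _ t = 0 := by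
  rw [← LinearMap.id_comp φ, ← superLTensor_comp_superLTensor h𝔮 a, LinearMap.comp_apply, ht,
    map_zero]

end SuperSym

namespace IsAbelianProjection

open SuperSym

variable {ι : Type} [Fintype ι] {π : ι → ZMod 2} {𝔮 : Submodule ℂ (Matrix ι ι ℂ)}
  {d : Matrix ι ι ℂ →ₗ[ℂ] Matrix ι ι ℂ} {V : Type} [AddCommGroup V] [Module ℂ V]

/-- The supermatrix `X` of parity `a` normalizes the range of the projection `d`. -/
def Normalizes (π : ι → ZMod 2) (d : Matrix ι ι ℂ →ₗ[ℂ] Matrix ι ι ℂ) (a : ZMod 2)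
    (X : Matrix ι ι ℂ) : Prop :=
  ∀ b, ∀ Y ∈ homog π b, d (sbracket a b X (d Y)) = sbracket a b X (d Y)

/-- The operator `ad X ⊗ 1` on `S(𝔤/𝔮) ⊗ V` for `X ∈ 𝔮` of parity `a` which normalizes the
complement of `𝔮`; it is what remains of the action of `X` after removing `1 ⊗ X`. -/
def symAct (hd : IsAbelianProjection π 𝔮 d) (M : SuperModule π 𝔮 V) (a : ZMod 2) (X : 𝔮) :
    Module.End ℂ (SuperSym π 𝔮 ⊗[ℂ] V) :=
  hd.tensorAct M X - superLTensor hd.isGraded a (M.act X)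

variable (hd : IsAbelianProjection π 𝔮 d) (M : SuperModule π 𝔮 V) {a b : ZMod 2} {H X : 𝔮}
  {Y : Matrix ι ι ℂ}

lemma symAct_one_tmul (a : ZMod 2) (X : 𝔮) (v : V) : hd.symAct M a X (1 ⊗ₜ v) = 0 := by
  rw [symAct, LinearMap.sub_apply, hd.tensorAct_one_tmul_of_mem M X.2, superLTensor_one_tmul,
    sub_self]

lemma symAct_gen_smul (hX : (X : Matrix ι ι ℂ) ∈ homog π a) (hXd : Normalizes π d a X)
    (hY : Y ∈ homog π b) (t : SuperSym π 𝔮 ⊗[ℂ] V) :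
    hd.symAct M a X (gen π 𝔮 Y • t) =
      gen π 𝔮 (sbracket a b X (d Y)) • t + sgn a b • gen π 𝔮 Y • hd.symAct M a X t := by
  rw [symAct, LinearMap.sub_apply, LinearMap.sub_apply, hd.tensorAct_gen_smul M hX hY, ← hXd b Y hY,
    hd.tensorAct_map M (SuperPair.sbracket_mem hX (hd.homog_mem b Y hY)), hXd b Y hY,
    superLTensor_gen_smul _ _ _ hY, sgn_comm b a, smul_sub, smul_sub, add_sub_assoc]

lemma lie_symAct_superLTensor (hH : (H : Matrix ι ι ℂ) ∈ homog π 0) (hHd : Normalizes π d 0 H)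
    (a : ZMod 2) (φ : Module.End ℂ V) :
    ⁅hd.symAct M 0 H, superLTensor hd.isGraded a φ⁆ = 0 := by
  rw [Ring.lie_def, sub_eq_zero]
  refine tensor_linearMap_eq (fun v => ?_) fun b Y hY t ht => ?_
  · rw [Module.End.mul_apply, Module.End.mul_apply, superLTensor_one_tmul, symAct_one_tmul,
      symAct_one_tmul, map_zero]
  · have hHY := SuperPair.sbracket_mem hH (hd.homog_mem b Y hY)
    rw [zero_add] at hHY
    rw [Module.End.mul_apply, Module.End.mul_apply] at ht ⊢
    rw [superLTensor_gen_smul _ _ _ hY, map_smul _ (sgn b a), hd.symAct_gen_smul M hH hHd hY,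
      hd.symAct_gen_smul M hH hHd hY, ht, map_add, sgn_zero_left, one_smul, one_smul,
      superLTensor_gen_smul _ _ _ hY, superLTensor_gen_smul _ _ _ hHY, smul_add]

lemma lie_symAct_symAct (hH : (H : Matrix ι ι ℂ) ∈ homog π 0) (hHd : Normalizes π d 0 H)
    (hX : (X : Matrix ι ι ℂ) ∈ homog π a) (hXd : Normalizes π d a X) {k : ℂ}
    (hHX : sbracket 0 a (H : Matrix ι ι ℂ) X = k • (X : Matrix ι ι ℂ)) :
    ⁅hd.symAct M 0 H, hd.symAct M a X⁆ = k • hd.symAct M a X := by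
  rw [Ring.lie_def, sub_eq_iff_eq_add]
  refine tensor_linearMap_eq (fun v => ?_) fun b Y hY t ht => ?_
  · simp only [Module.End.mul_apply, LinearMap.add_apply, LinearMap.smul_apply, symAct_one_tmul,
      map_zero, smul_zero, add_zero]
  · have hHY := SuperPair.sbracket_mem hH (hd.homog_mem b Y hY)
    have hXY := SuperPair.sbracket_mem hX (hd.homog_mem b Y hY)
    have jacobi : sbracket 0 (a + b) (H : Matrix ι ι ℂ) (sbracket a b X (d Y)) =
        k • sbracket a b X (d Y) + sbracket a b X (sbracket 0 b H (d Y)) := by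
      have hsmul : k • sbracket a b X (d Y) = sbracket a b (k • (X : Matrix ι ι ℂ)) (d Y) := by
        simp only [sbracket, smul_mul_assoc, mul_smul_comm, smul_sub, smul_comm k]
      rw [hsmul, ← hHX]
      simp only [sbracket, sgn_zero_left, one_smul, mul_sub, sub_mul, smul_mul_assoc,
        mul_smul_comm, mul_assoc]
      module
    rw [zero_add] at hHY
    simp only [Module.End.mul_apply, LinearMap.add_apply, LinearMap.smul_apply] at ht ⊢
    rw [hd.symAct_gen_smul M hX hXd hY, hd.symAct_gen_smul M hH hHd hY, map_add, map_add,
      map_smul _ (sgn a b), map_smul _ (sgn 0 b), hd.symAct_gen_smul M hH hHd hXY,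
      hd.symAct_gen_smul M hH hHd hY, hd.symAct_gen_smul M hX hXd hHY,
      hd.symAct_gen_smul M hX hXd hY, hXd b Y hY, hHd b Y hY, jacobi, ht]
    simp only [← genAct_apply, sgn_zero_left]
    simp only [map_add, map_smul, LinearMap.add_apply, LinearMap.smul_apply]
    module

variable {x : ℂ} {w w₀ : SuperSym π 𝔮 ⊗[ℂ] V}

lemma lTensor_act_leading_component_eq_zero (hH : (H : Matrix ι ι ℂ) ∈ homog π 0)
    (hHd : Normalizes π d 0 H) (hX : (X : Matrix ι ι ℂ) ∈ homog π a) (hXd : Normalizes π d a X)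
    {k : ℕ} (hHX : sbracket 0 a (H : Matrix ι ι ℂ) X = ((k + 1 : ℕ) : ℂ) • (X : Matrix ι ι ℂ))
    (hw₀ : hd.symAct M 0 H w₀ = x • w₀)
    (hw : w - w₀ ∈ eigenspaceFrom (hd.symAct M 0 H) (x + 1)) (hXw : hd.tensorAct M X w = 0) :
    (M.act X).lTensor _ w₀ = 0 := by
  refine lTensor_eq_zero_of_superLTensor_eq_zero hd.isGraded a _ <|
    apply_leading_component_eq_zero (hd.lie_symAct_superLTensor M hH hHd a _) hw₀ hw ?_
  have hwx : w ∈ eigenspaceFrom (hd.symAct M 0 H) x := by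
    have hw₀x : w₀ ∈ eigenspaceFrom (hd.symAct M 0 H) x :=
      mem_eigenspaceFrom 0 (by rw [Nat.cast_zero, add_zero, hw₀])
    have hle := eigenspaceFrom_add_natCast_le (hd.symAct M 0 H) x 1
    rw [Nat.cast_one] at hle
    simpa only [add_sub_cancel] using add_mem hw₀x (hle hw)
  have hsym : hd.symAct M a X w = -superLTensor hd.isGraded a (M.act X) w := by
    rw [symAct, LinearMap.sub_apply, hXw, zero_sub]
  have hsym_mem : hd.symAct M a X w ∈ eigenspaceFrom (hd.symAct M 0 H) (x + 1) := by
    have hraise := eigenspaceFrom_le_comap_of_lie_eq_smul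
      (hd.lie_symAct_symAct M hH hHd hX hXd hHX) x hwx
    have hle := eigenspaceFrom_add_natCast_le (hd.symAct M 0 H) (x + 1) k
    rw [add_right_comm, add_assoc, ← Nat.cast_add_one] at hle
    exact hle hraise
  rw [hsym] at hsym_mem
  exact neg_mem_iff.1 hsym_mem

lemma tensorAct_leading_component (hH : (H : Matrix ι ι ℂ) ∈ homog π 0)
    (hHd : Normalizes π d 0 H) (hX : (X : Matrix ι ι ℂ) ∈ homog π 0) (hXd : Normalizes π d 0 X)
    (hHX : sbracket 0 0 (H : Matrix ι ι ℂ) X = 0) (hw₀ : hd.symAct M 0 H w₀ = x • w₀)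
    (hw : w - w₀ ∈ eigenspaceFrom (hd.symAct M 0 H) (x + 1)) {y : ℂ}
    (hXw : hd.tensorAct M X w = y • w) : hd.tensorAct M X w₀ = y • w₀ := by
  have hlie := hd.lie_symAct_symAct M hH hHd hX hXd (hHX.trans (zero_smul ℂ _).symm)
  refine apply_leading_component_eq_smul ?_ hw₀ hw hXw
  rw [← sub_add_cancel (hd.tensorAct M X) (superLTensor hd.isGraded 0 (M.act X))]
  exact commute_iff_lie_eq.1 <|
    (commute_iff_lie_eq.2 <| hlie.trans (zero_smul _ _)).add_right <|
      commute_iff_lie_eq.2 (hd.lie_symAct_superLTensor M hH hHd 0 _)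

end IsAbelianProjection

/-! ### Singular vectors in `S(𝔭⁻) ⊗ V` -/

section Blocks

variable {p q : ℕ}

/-- The projection of `𝔤` onto `𝔭⁻`, the lower left block, along `𝔮`. -/
def lowerLeft (p q : ℕ) : G p q →ₗ[ℂ] G p q where
  toFun X := Matrix.fromBlocks 0 0 X.toBlocks₂₁ 0
  map_add' X Y := by
    rw [Matrix.fromBlocks_add]
    simp only [add_zero]
    rfl
  map_smul' c X := by
    rw [RingHom.id_apply, Matrix.fromBlocks_smul]
    simp only [smul_zero]
    rfl

lemma lowerLeft_apply (X : G p q) : lowerLeft p q X = Matrix.fromBlocks 0 0 X.toBlocks₂₁ 0 := rfl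

lemma lowerLeft_mul_lowerLeft (X Y : G p q) : lowerLeft p q X * lowerLeft p q Y = 0 := by
  rw [lowerLeft_apply, lowerLeft_apply, Matrix.fromBlocks_multiply]
  simp only [Matrix.zero_mul, Matrix.mul_zero, add_zero, Matrix.fromBlocks_zero]

lemma mul_mem_𝔮 {X Y : G p q} (hX : X ∈ 𝔮 p q) (hY : Y ∈ 𝔮 p q) : X * Y ∈ 𝔮 p q := by
  intro i j
  rw [Matrix.mul_apply]
  refine Finset.sum_eq_zero fun k _ => ?_
  rcases k with k | k
  · rw [hX i k, zero_mul]
  · rw [hY k j, mul_zero]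

variable (p q) in
lemma isAbelianProjection_lowerLeft :
    IsAbelianProjection (parity₂ p q) (𝔮 p q) (lowerLeft p q) where
  sub_mem X i j := by
    rw [Matrix.sub_apply, lowerLeft_apply, Matrix.fromBlocks_apply₂₁]
    exact sub_self _
  eq_zero X hX := by
    have hX₂₁ : X.toBlocks₂₁ = 0 := Matrix.ext hX
    rw [lowerLeft_apply, hX₂₁, Matrix.fromBlocks_zero]
  isGraded := isGraded_𝔮 p q
  homog_mem a X hX := by
    rintro (i | i) (j | j) h
    · rfl
    · rfl
    · exact hX _ _ h
    · rfl
  sbracket_eq_zero a b X _ Y _ := by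
    rw [sbracket, lowerLeft_mul_lowerLeft, lowerLeft_mul_lowerLeft, smul_zero, sub_zero]
  sbracket_mem a b X hX Y hY :=
    (𝔮 p q).sub_mem (mul_mem_𝔮 hX.1 hY.1) ((𝔮 p q).smul_mem _ (mul_mem_𝔮 hY.1 hX.1))

/-- The embedding of `gl(p|q)` as the upper left block. -/
def upperLeft : Matrix (Fin p ⊕ Fin q) (Fin p ⊕ Fin q) ℂ →ₗ[ℂ] 𝔮 p q where
  toFun X := ⟨Matrix.fromBlocks X 0 0 0, fun _ _ => rfl⟩
  map_add' X Y := Subtype.ext <| by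
    rw [Submodule.coe_add, Matrix.fromBlocks_add]
    simp only [add_zero]
  map_smul' c X := Subtype.ext <| by
    rw [Submodule.coe_smul, Matrix.fromBlocks_smul]
    simp only [smul_zero, RingHom.id_apply]

lemma coe_upperLeft (X : Matrix (Fin p ⊕ Fin q) (Fin p ⊕ Fin q) ℂ) :
    (upperLeft X : G p q) = Matrix.fromBlocks X 0 0 0 := rfl

lemma upperLeft_mem_homog {a : ZMod 2} {X : Matrix (Fin p ⊕ Fin q) (Fin p ⊕ Fin q) ℂ}
    (hX : X ∈ homog (parity p q) a) : (upperLeft X : G p q) ∈ homog (parity₂ p q) a := by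
  rintro (i | i) (j | j) h
  · exact hX _ _ h
  · rfl
  · rfl
  · rfl

lemma sbracket_upperLeft (a b : ZMod 2) (X Y : Matrix (Fin p ⊕ Fin q) (Fin p ⊕ Fin q) ℂ) :
    sbracket a b (upperLeft X : G p q) (upperLeft Y) = upperLeft (sbracket a b X Y) := by
  rw [sbracket, sbracket, coe_upperLeft, coe_upperLeft, Matrix.fromBlocks_multiply,
    Matrix.fromBlocks_multiply, map_sub, map_smul, Submodule.coe_sub, Submodule.coe_smul,
    coe_upperLeft, coe_upperLeft]
  simp only [Matrix.zero_mul, Matrix.mul_zero, add_zero]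

lemma sbracket_upperLeft_lowerLeft (a b : ZMod 2)
    (X : Matrix (Fin p ⊕ Fin q) (Fin p ⊕ Fin q) ℂ) (Y : G p q) :
    sbracket a b (upperLeft X : G p q) (lowerLeft p q Y) =
      lowerLeft p q (-(sgn a b • (Y * upperLeft X))) := by
  have toBlocks₂₁_mul : (Y * Matrix.fromBlocks X 0 0 0).toBlocks₂₁ = Y.toBlocks₂₁ * X := by
    ext i j
    simp [Matrix.toBlocks₂₁, Matrix.mul_apply]
  rw [map_neg, map_smul, sbracket, coe_upperLeft, lowerLeft_apply, lowerLeft_apply, toBlocks₂₁_mul,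
    Matrix.fromBlocks_multiply, Matrix.fromBlocks_multiply]
  simp only [Matrix.zero_mul, Matrix.mul_zero, add_zero, Matrix.fromBlocks_zero, zero_sub]

open IsAbelianProjection in
lemma normalizes_upperLeft (a : ZMod 2) (X : Matrix (Fin p ⊕ Fin q) (Fin p ⊕ Fin q) ℂ) :
    Normalizes (parity₂ p q) (lowerLeft p q) a (upperLeft X : G p q) := fun b Y _ => by
  rw [sbracket_upperLeft_lowerLeft, (isAbelianProjection_lowerLeft p q).map_map]

end Blocks

section Extraction

open IsAbelianProjection

variable {p q : ℕ} {V : Type} [AddCommGroup V] [Module ℂ V]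
  (M : SuperModule (parity₂ p q) (𝔮 p q) V)

/-- The grading operator of `S(𝔭⁻) ⊗ V` in which a generator from column `i` has degree `c i`. -/
def colDegree (c : Fin p ⊕ Fin q → ℂ) :
    Module.End ℂ (SuperSym (parity₂ p q) (𝔮 p q) ⊗[ℂ] V) :=
  (isAbelianProjection_lowerLeft p q).symAct M 0 (upperLeft (-Matrix.diagonal c))

lemma upperLeft_diagonal (c : Fin p ⊕ Fin q → ℂ) :
    (upperLeft (Matrix.diagonal c) : G p q) = Matrix.diagonal (Sum.elim c 0) := by
  have h := Matrix.fromBlocks_diagonal c (0 : Fin p ⊕ Fin q → ℂ)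
  rwa [Matrix.diagonal_zero'] at h

variable {M} {η κ : Fin p ⊕ Fin q → ℂ} {w : SuperSym (parity₂ p q) (𝔮 p q) ⊗[ℂ] V}

lemma lie_colDegree_genAct_single (c : Fin p ⊕ Fin q → ℂ)
    (i j : (Fin p ⊕ Fin q) ⊕ (Fin p ⊕ Fin q)) :
    ⁅colDegree M c, SuperSym.genAct (parity₂ p q) (𝔮 p q) V (Matrix.single i j 1)⁆ =
      Sum.elim c 0 j •
        SuperSym.genAct (parity₂ p q) (𝔮 p q) V (Matrix.single i j 1) := by
  have hd := isAbelianProjection_lowerLeft p q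
  have single_mul_upperLeft : Matrix.single i j 1 * (upperLeft (-Matrix.diagonal c) : G p q) =
      -(Sum.elim c 0 j • Matrix.single i j 1) := by
    rw [map_neg, Submodule.coe_neg, mul_neg, upperLeft_diagonal]
    ext k l
    simp only [Matrix.neg_apply, Matrix.mul_diagonal, Matrix.smul_apply, Matrix.single_apply,
      smul_eq_mul]
    split_ifs with h
    · rw [h.2, mul_comm]
    · rw [zero_mul, mul_zero]
  refine LinearMap.ext fun t => ?_
  rw [Ring.lie_def, LinearMap.sub_apply, Module.End.mul_apply, Module.End.mul_apply, colDegree,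
    SuperSym.genAct_apply, SuperSym.genAct_apply,
    hd.symAct_gen_smul M (upperLeft_mem_homog (neg_mem (diagonal_mem_homog _ c)))
      (normalizes_upperLeft 0 _) (single_one_mem_homog _ i j),
    sbracket_upperLeft_lowerLeft, hd.gen_map, sgn_zero_left, one_smul, one_smul,
    single_mul_upperLeft, neg_neg, add_sub_cancel_right, map_smul, smul_assoc,
    LinearMap.smul_apply, SuperSym.genAct_apply]

lemma eigenspaceFrom_colDegree_natCast_eq_top (c : Fin p ⊕ Fin q → ℕ) :
    eigenspaceFrom (colDegree M fun i => (c i : ℂ)) 0 = ⊤ := by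
  refine eq_top_iff.2 fun t _ => ?_
  induction t using SuperSym.tensor_induction with
  | one_tmul v =>
    exact mem_eigenspaceFrom 0 (by
      rw [colDegree, symAct_one_tmul, Nat.cast_zero, add_zero, zero_smul])
  | add s t hs ht => exact add_mem (hs trivial) (ht trivial)
  | smul r t ht => exact Submodule.smul_mem _ r (ht trivial)
  | gen_smul _ Y _ t ht =>
    refine linearMap_apply_mem_of_single
      (f := (SuperSym.genAct (parity₂ p q) (𝔮 p q) V).flip t) (fun i j => ?_) Y
    have natCast_elim : Sum.elim (fun i => (c i : ℂ)) 0 j = ((Sum.elim c 0 j : ℕ) : ℂ) := by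
      rcases j with j | _
      · rfl
      · exact Nat.cast_zero.symm
    exact eigenspaceFrom_add_natCast_le _ 0 _ <| eigenspaceFrom_le_comap_of_lie_eq_smul
      ((lie_colDegree_genAct_single _ i j).trans (by rw [natCast_elim])) 0 (ht trivial)

lemma exists_lTensor_act_singular (hw : w ≠ 0)
    (hup : ∀ i j : Fin p ⊕ Fin q, ht i < ht j → (isAbelianProjection_lowerLeft p q).tensorAct M
      (upperLeft (Matrix.single i j 1) : G p q) w = 0)
    (hdiag : ∀ i : Fin p ⊕ Fin q, (isAbelianProjection_lowerLeft p q).tensorAct M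
      (upperLeft (Matrix.single i i 1) : G p q) w = η i • w) :
    ∃ w₀ ≠ 0, (∀ i j : Fin p ⊕ Fin q, ht i < ht j →
        (M.act (upperLeft (Matrix.single i j 1))).lTensor _ w₀ = 0) ∧
      ∀ i : Fin p ⊕ Fin q, (isAbelianProjection_lowerLeft p q).tensorAct M
        (upperLeft (Matrix.single i i 1) : G p q) w₀ = η i • w₀ := by
  have hH : -heightMatrix (ht (p := p) (q := q)) ∈ homog (parity p q) 0 :=
    neg_mem (diagonal_mem_homog _ _)
  have sbracket_eq (i j : Fin p ⊕ Fin q) (a : ZMod 2) :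
      sbracket 0 a (upperLeft (p := p) (q := q) (-heightMatrix ht) : G p q)
        (upperLeft (Matrix.single i j 1)) =
        ((ht j : ℂ) - ht i) • (upperLeft (Matrix.single i j 1) : G p q) := by
    rw [sbracket_upperLeft, sbracket, sgn_zero_left, one_smul, neg_mul, mul_neg, ← neg_sub',
      heightMatrix, diagonal_mul_single_sub, ← neg_smul, neg_sub, map_smul, Submodule.coe_smul]
  obtain ⟨n, w₀, hw₀, hdeg, hlead⟩ := exists_leading_component
    ((eigenspaceFrom_colDegree_natCast_eq_top (M := M) ht).ge (Submodule.mem_top (x := w))) hw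
  refine ⟨w₀, hw₀, fun i j hij => ?_, fun i => ?_⟩
  · obtain ⟨k, hk⟩ := Nat.exists_eq_add_of_lt hij
    refine lTensor_act_leading_component_eq_zero _ M (upperLeft_mem_homog hH)
      (normalizes_upperLeft 0 _) (upperLeft_mem_homog (single_one_mem_homog _ i j))
      (normalizes_upperLeft _ _) (k := k) ?_ hdeg hlead (hup i j hij)
    rw [sbracket_eq, hk]
    push_cast
    congr 1
    ring
  · have hE := single_one_mem_homog (parity p q) i i
    rw [CharTwo.add_self_eq_zero] at hE
    refine tensorAct_leading_component _ M (upperLeft_mem_homog hH) (normalizes_upperLeft 0 _)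
      (upperLeft_mem_homog hE) (normalizes_upperLeft _ _) ?_ hdeg hlead (hdiag i)
    rw [sbracket_eq, sub_self, zero_smul]

lemma exists_eq_add_natCast_of_tensorAct_single {i : Fin p ⊕ Fin q} {x y : ℂ} (hw : w ≠ 0)
    (hlTensor : (M.act (upperLeft (Matrix.single i i 1))).lTensor _ w = x • w)
    (htensorAct : (isAbelianProjection_lowerLeft p q).tensorAct M
      (upperLeft (Matrix.single i i 1) : G p q) w = y • w) : ∃ n : ℕ, x = y + n := by
  have hdeg : colDegree M (fun k => ((Pi.single i 1 : Fin p ⊕ Fin q → ℕ) k : ℂ)) w =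
      (x - y) • w := by
    have diagonal_eq : (Matrix.diagonal fun k => ((Pi.single i 1 : Fin p ⊕ Fin q → ℕ) k : ℂ)) =
        Matrix.single i i 1 := by
      rw [← Matrix.diagonal_single]
      congr 1
      ext k
      rw [Pi.single_apply, Pi.single_apply, Nat.cast_ite, Nat.cast_one, Nat.cast_zero]
    rw [colDegree, diagonal_eq, symAct, map_neg, LinearMap.sub_apply, SuperSym.superLTensor_zero,
      map_neg, LinearMap.lTensor_neg, Submodule.coe_neg, map_neg, LinearMap.neg_apply,
      LinearMap.neg_apply, hlTensor, htensorAct, neg_sub_neg]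
    exact (sub_smul x y w).symm
  obtain ⟨n, hn⟩ := exists_eq_add_natCast_of_mem_eigenspaceFrom
    ((eigenspaceFrom_colDegree_natCast_eq_top _).ge Submodule.mem_top) hw hdeg
  exact ⟨n, by linear_combination hn⟩

end Extraction

/-! ### Homomorphisms into the generalized Verma module -/

lemma SuperModule.exists_mem_homOfParity {ι : Type} [Fintype ι] {π : ι → ZMod 2}
    {𝔰 : Submodule ℂ (Matrix ι ι ℂ)} {V₁ V₂ : Type} [AddCommGroup V₁] [Module ℂ V₁]
    [AddCommGroup V₂] [Module ℂ V₂] {M : SuperModule π 𝔰 V₁} {N : SuperModule π 𝔰 V₂}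
    (h : M.Hom N ≠ ⊥) : ∃ c, ∃ f ∈ M.homOfParity N c, f ≠ 0 := by
  by_contra! h'
  have hbot (c : ZMod 2) : M.homOfParity N c = ⊥ := (Submodule.eq_bot_iff _).2 (h' c)
  exact h (by rw [SuperModule.Hom, hbot, hbot, sup_bot_eq])

section Outer

variable {p q : ℕ} {V₁ V₂ V₃ : Type} [AddCommGroup V₁] [Module ℂ V₁] [AddCommGroup V₂]
  [Module ℂ V₂] [AddCommGroup V₃] [Module ℂ V₃] (M : SuperModule (parity p q) ⊤ V₁)
  (N : SuperModule (parity p q) ⊤ V₂)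

lemma outer_act_of_blk₂_eq_zero {X : 𝔨 p q} (hX : blk₂ (X : G p q) = 0) :
    (outer M N).act X = (M.act (full (blk₁ X))).rTensor V₂ := by
  have full_zero : full (0 : Matrix (Fin p ⊕ Fin q) (Fin p ⊕ Fin q) ℂ) = 0 := rfl
  change outerAct M N X = _
  simp only [outerAct, LinearMap.coe_mk, AddHom.coe_mk, hX, map_zero, full_zero,
    TensorProduct.map_zero_right, add_zero]
  rfl

lemma inflate_outer_act_upperLeft (X : Matrix (Fin p ⊕ Fin q) (Fin p ⊕ Fin q) ℂ) :
    (inflate (outer M N)).act (upperLeft X) = (M.act (full X)).rTensor V₂ :=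
  outer_act_of_blk₂_eq_zero M N (X := levi (upperLeft X)) rfl

lemma upperLeft_mem_𝔨 (X : Matrix (Fin p ⊕ Fin q) (Fin p ⊕ Fin q) ℂ) :
    (upperLeft X : G p q) ∈ 𝔨 p q := fun _ _ => ⟨rfl, rfl⟩

variable {M N}

lemma hom_outer_act_tmul {T : SuperModule (parity₂ p q) (𝔨 p q) V₃} {c : ZMod 2}
    {f : V₁ ⊗[ℂ] V₂ →ₗ[ℂ] V₃} (hf : f ∈ (outer M N).homOfParity T c) {a : ZMod 2}
    {X : Matrix (Fin p ⊕ Fin q) (Fin p ⊕ Fin q) ℂ} (hX : X ∈ homog (parity p q) a)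
    (x : V₁) (y : V₂) :
    f (M.act (full X) x ⊗ₜ y) = sgn a c • T.act ⟨upperLeft X, upperLeft_mem_𝔨 X⟩ (f (x ⊗ₜ y)) := by
  rw [← hf.2 a ⟨upperLeft X, upperLeft_mem_𝔨 X⟩ (upperLeft_mem_homog hX),
    outer_act_of_blk₂_eq_zero M N (X := ⟨upperLeft X, upperLeft_mem_𝔨 X⟩) rfl,
    LinearMap.rTensor_tmul]
  rfl

end Outer

section HighestWeightModule

variable {p q : ℕ} {η κ : Fin p ⊕ Fin q → ℂ} {V V₂ V₃ : Type} [AddCommGroup V] [Module ℂ V]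
  [AddCommGroup V₂] [Module ℂ V₂] [AddCommGroup V₃] [Module ℂ V₃]
  {N : SuperModule (parity p q) ⊤ V₂} {c : ZMod 2}

lemma exists_hwVec_tmul_ne_zero {T : SuperModule (parity₂ p q) (𝔨 p q) V₃}
    {f : LSpace η ⊗[ℂ] V₂ →ₗ[ℂ] V₃} (hf : f ∈ (outer (L η) N).homOfParity T c) (hf₀ : f ≠ 0) :
    ∃ y, f (hwVec η ⊗ₜ y) ≠ 0 := by
  by_contra! h
  set P : Submodule ℂ (LSpace η) := LinearMap.ker (TensorProduct.curry f)
  have mem_P (x : LSpace η) : x ∈ P ↔ ∀ y, f (x ⊗ₜ y) = 0 :=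
    LinearMap.mem_ker.trans LinearMap.ext_iff
  have stable (X : Matrix (Fin p ⊕ Fin q) (Fin p ⊕ Fin q) ℂ) :
      P ≤ P.comap (uAct (parity p q) (LSpace η) X) := fun x hx =>
    linearMap_apply_mem_of_single (f := (uAct (parity p q) (LSpace η)).flip x)
      (fun i j => (mem_P _).2 fun y => by
        refine (hom_outer_act_tmul hf (single_one_mem_homog _ i j) x y).trans ?_
        rw [(mem_P x).1 hx y, map_zero, smul_zero]) X
  refine hf₀ (TensorProduct.ext' fun x y => ?_)
  obtain ⟨u, rfl⟩ := exists_eq_smul_hwVec η x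
  exact (mem_P _).1 (U.smul_mem_of_le_comap stable u ((mem_P _).2 h)) y

lemma exists_singular_of_hom_Ind {M : SuperModule (parity₂ p q) (𝔮 p q) V}
    {f : LSpace η ⊗[ℂ] V₂ →ₗ[ℂ] M.IndSpace}
    (hf : f ∈ (outer (L η) N).homOfParity
      ((M.Ind (isGraded_𝔮 p q)).restrict (𝔰 := 𝔨 p q) le_top) c) (hf₀ : f ≠ 0) :
    ∃ w : SuperSym (parity₂ p q) (𝔮 p q) ⊗[ℂ] V, w ≠ 0 ∧
      (∀ i j : Fin p ⊕ Fin q, ht i < ht j → (isAbelianProjection_lowerLeft p q).tensorAct M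
        (upperLeft (Matrix.single i j 1) : G p q) w = 0) ∧
      ∀ i : Fin p ⊕ Fin q, (isAbelianProjection_lowerLeft p q).tensorAct M
        (upperLeft (Matrix.single i i 1) : G p q) w = η i • w := by
  obtain ⟨y, hy⟩ := exists_hwVec_tmul_ne_zero hf hf₀
  have hd := isAbelianProjection_lowerLeft p q
  have of_smul (i j : Fin p ⊕ Fin q) :
      f (uAct (parity p q) (LSpace η) (Matrix.single i j 1) (hwVec η) ⊗ₜ y) =
        sgn (parity p q i + parity p q j) c •
          (U.of (parity₂ p q) (upperLeft (Matrix.single i j 1) : G p q) • f (hwVec η ⊗ₜ y)) :=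
    hom_outer_act_tmul hf (single_one_mem_homog _ i j) (hwVec η) y
  refine ⟨hd.toTensor M (f (hwVec η ⊗ₜ y)), fun h => hy ?_, fun i j hij => ?_, fun i => ?_⟩
  · exact hd.toTensor_injective M (h.trans (map_zero _).symm)
  · have h := of_smul i j
    rw [mem_singularVectors.1 (hwVec_mem_singularVectors η) i j hij, TensorProduct.zero_tmul,
      map_zero, eq_comm, smul_eq_zero_iff_right (sgn_ne_zero _ _)] at h
    rw [← hd.toTensor_of_smul, h, map_zero]
  · have h := of_smul i i
    rw [uAct_single_self_hwVec, ← TensorProduct.smul_tmul', map_smul, CharTwo.add_self_eq_zero,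
      sgn_zero_left, one_smul] at h
    rw [← hd.toTensor_of_smul, ← h, map_smul]

lemma singularVectors_LSpace_le_ker (κ : Fin p ⊕ Fin q → ℂ) (i : Fin p ⊕ Fin q) :
    singularVectors ht (parity p q) (LSpace κ) ≤
      LinearMap.ker (uAct (parity p q) (LSpace κ) (Matrix.single i i 1) - κ i • LinearMap.id) := by
  refine (singularVectors_LSpace_le κ).trans ((Submodule.span_singleton_le_iff_mem _ _).2 ?_)
  rw [LinearMap.mem_ker, LinearMap.sub_apply, uAct_single_self_hwVec, LinearMap.smul_apply,
    LinearMap.id_apply, sub_self]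

lemma lTensor_act_single_self_of_singular {S : Type*} [AddCommGroup S] [Module ℂ S]
    {w : S ⊗[ℂ] (LSpace κ ⊗[ℂ] V₂)} (hw : ∀ i j : Fin p ⊕ Fin q, ht i < ht j →
      ((inflate (outer (L κ) N)).act (upperLeft (Matrix.single i j 1))).lTensor S w = 0)
    (i : Fin p ⊕ Fin q) :
    ((inflate (outer (L κ) N)).act (upperLeft (Matrix.single i i 1))).lTensor S w = κ i • w := by
  have act_eq (X : Matrix (Fin p ⊕ Fin q) (Fin p ⊕ Fin q) ℂ) :
      (inflate (outer (L κ) N)).act (upperLeft X) =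
        (uAct (parity p q) (LSpace κ) X).rTensor V₂ := inflate_outer_act_upperLeft (L κ) N X
  simp only [act_eq] at hw ⊢
  have hker := iInf_ker_lTensor_le S (iInf_ker_rTensor_le V₂ (singularVectors_LSpace_le_ker κ i))
    ((Submodule.mem_iInf _).2 fun ij => LinearMap.mem_ker.2 (hw ij.1.1 ij.1.2 ij.2))
  rwa [LinearMap.mem_ker, LinearMap.rTensor_sub, LinearMap.rTensor_smul, LinearMap.rTensor_id,
    LinearMap.lTensor_sub, LinearMap.lTensor_smul, LinearMap.lTensor_id, LinearMap.sub_apply,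
    LinearMap.smul_apply, LinearMap.id_apply, sub_eq_zero] at hker

end HighestWeightModule

lemma le_of_natWeight {p q : ℕ} {lam mu : YoungDiagram} (hmu : IsHook p q mu)
    (h : ∀ i : Fin p ⊕ Fin q, ∃ n : ℕ, natWeight lam i = natWeight mu i + n) : mu ≤ lam := by
  rintro ⟨i, j⟩ hij
  by_cases hi : i < p
  · obtain ⟨n, hn⟩ := h (Sum.inl ⟨i, hi⟩)
    have rowLen_eq : lam.rowLen i = mu.rowLen i + n := by
      simp only [natWeight, Sum.elim_inl] at hn
      exact_mod_cast hn
    rw [YoungDiagram.mem_iff_lt_rowLen] at hij ⊢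
    omega
  · have hj : j < q := calc
      j < mu.rowLen i := YoungDiagram.mem_iff_lt_rowLen.1 hij
      _ ≤ mu.rowLen p := mu.rowLen_anti p i (not_lt.1 hi)
      _ ≤ q := hmu
    obtain ⟨n, hn⟩ := h (Sum.inr ⟨j, hj⟩)
    have colLen_eq : lam.colLen j - p = mu.colLen j - p + n := by
      simp only [natWeight, Sum.elim_inr] at hn
      exact_mod_cast hn
    rw [YoungDiagram.mem_iff_lt_colLen] at hij ⊢
    omega

end SuperPair

open SuperPair in
theorem mainTheorem9_general {p q : ℕ} {η κ : Fin p ⊕ Fin q → ℂ} {V₁ V₂ : Type} [AddCommGroup V₁]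
    [Module ℂ V₁] [AddCommGroup V₂] [Module ℂ V₂] {N₁ : SuperModule (parity p q) ⊤ V₁}
    {N₂ : SuperModule (parity p q) ⊤ V₂}
    (h : (outer (L η) N₁).Hom (((inflate (outer (L κ) N₂)).Ind (isGraded_𝔮 p q)).restrict
      (𝔰 := 𝔨 p q) le_top) ≠ ⊥) (i : Fin p ⊕ Fin q) :
    ∃ n : ℕ, κ i = η i + n := by
  obtain ⟨c, f, hf, hf₀⟩ := SuperModule.exists_mem_homOfParity h
  obtain ⟨w, hw, hup, hdiag⟩ := exists_singular_of_hom_Ind hf hf₀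
  obtain ⟨w₀, hw₀, hup₀, hdiag₀⟩ := exists_lTensor_act_singular hw hup hdiag
  exact exists_eq_add_natCast_of_tensorAct_single hw₀
    (lTensor_act_single_self_of_singular hup₀ i) (hdiag₀ i)

theorem mainTheorem9 (p q : ℕ) (lam mu : YoungDiagram)
    (hlam : SuperPair.IsHook p q lam) (hmu : SuperPair.IsHook p q mu)
    (h : (SuperPair.W p q mu).Hom ((SuperPair.I p q lam).restrict (𝔰 := SuperPair.𝔨 p q) le_top) ≠ ⊥) :
    mu ≤ lam :=
  SuperPair.le_of_natWeight hmu (mainTheorem9_general h)
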